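/- Let $n\ge 1$ and $R>0$. Let ${\cal U}_R$ be the class of all closed and bounded sets $E\subset\mathbb R^n$ such that for every $p\in\partial E$ there are points $p',p''\in\mathbb R^n$ with $p\in\partial B(p',R)\cap\partial B(p'',R)$, $B(p',R)\subset E$ and $B(p'',R)\cap E=\emptyset$, where $B(q,R)$ is the open ball with centre $q$ and radius $R$. For $E\in{\cal U}_R$ and $p\in\partial E$ (the points $p',p''$ are then unique), let ${\cal S}_p(E)$ be the class of all orthonormal coordinate systems $(x,z)\in\mathbb R^{n-1}\times\mathbb R$ centred at $p$ whose $n$-th basis vector is $\frac1{2R}(p''-p')$. A sequence of closed sets $E_h\subset\mathbb R^n$ converges to a closed set $E$ in the sense of Kuratowski if (i) every limit of a sequence of points $p_k\in E_{h_k}$ with $h_1<h_2<\cdots$ belongs to $E$, and (ii) for every $p\in E$ there are $p_h\in E_h$ with $p_h\to p$. It converges in $L^1$ if $\chi_{E_h}\to\chi_E$ in $L^1(\mathbb R^n)$. Then there is a constant $\eta\in\,]0,1[$, depending only on $R$ (and on the dimension $n$), such that the following holds. Let $\{E_h\}_h$ be a sequence of sets in ${\cal U}_R$ that are all contained in one bounded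 set. Then there exist $E\in{\cal U}_R$ and a subsequence $\{E_{h_j}\}_j$ such that a) $E_{h_j}\to E$ in the sense of Kuratowski and in $L^1$; b) $\partial E_{h_j}\to\partial E$ in the sense of Kuratowski, ${\cal H}^{n-1}(\partial E)<\infty$ and $\lim_{j\to\infty}{\cal H}^{n-1}(\partial E_{h_j})={\cal H}^{n-1}(\partial E)$; c) for every $p\in\partial E$ and every coordinate system in ${\cal S}_p(E)$, if $C^\eta=\{|x|\le\eta R\}\times[-\eta R,\eta R]$ and $S^\eta=\{|x|\le \eta R\}$ in these coordinates, then $\partial E\cap C^\eta$ is the graph of a continuous function $f\in W^{2,\infty}(S^\eta)$, and there are continuous functions $f_j\in W^{2,\infty}(S^\eta)$ such that $\partial E_{h_j}\cap C^\eta$ is the graph of $f_j$ for all sufficiently large $j$, and $f_j\to f$ weakly* in $W^{2,\infty}(S^\eta)$, that is, $f_j$ and all its weak partial derivatives of order one and two converge weakly* in $L^\infty(S^\eta)$ to the corresponding derivatives of $f$. -/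

import Mathlib

open MeasureTheory Filter Topology
open scoped ContDiff

noncomputable section

/-- `n`-dimensional Euclidean space. -/
abbrev Euc (n : ℕ) : Type := EuclideanSpace ℝ (Fin n)

/-- `p'` and `p''` are centres of an interior, respectively exterior, ball of radius `R`
touching the boundary of `E` at `p`. -/
def IsTouchingPair {n : ℕ} (R : ℝ) (E : Set (Euc n)) (p p' p'' : Euc n) : Prop :=
  p ∈ Metric.sphere p' R ∧ p ∈ Metric.sphere p'' R ∧
    Metric.ball p' R ⊆ E ∧ Metric.ball p'' R ∩ E = ∅

/-- The class of closed bounded sets satisfying the interior and exterior sphere condition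
with radius `R` at every boundary point. -/
def classU (n : ℕ) (R : ℝ) : Set (Set (Euc n)) :=
  {E | IsClosed E ∧ Bornology.IsBounded E ∧
    ∀ p ∈ frontier E, ∃ p' p'' : Euc n, IsTouchingPair R E p p' p''}

/-- Convergence in the sense of Kuratowski of a sequence of sets: every limit of a subsequence
of points of the sets `E h` lies in `L`, and every point of `L` is the limit of a sequence of
points of the sets `E h`. -/
def KuratowskiTendsto {n : ℕ} (E : ℕ → Set (Euc n)) (L : Set (Euc n)) : Prop :=
  (∀ (k : ℕ → ℕ) (q : ℕ → Euc n) (p : Euc n), StrictMono k → (∀ i, q i ∈ E (k i)) →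
      Tendsto q atTop (𝓝 p) → p ∈ L) ∧
    ∀ p ∈ L, ∃ q : ℕ → Euc n, (∀ h, q h ∈ E h) ∧ Tendsto q atTop (𝓝 p)

/-- Convergence of characteristic functions in `L¹(ℝⁿ)`. -/
def L1SetTendsto {n : ℕ} (E : ℕ → Set (Euc n)) (L : Set (Euc n)) : Prop :=
  Tendsto (fun h => eLpNorm ((E h).indicator (fun _ => (1 : ℝ)) - L.indicator (fun _ => (1 : ℝ)))
    1 volume) atTop (𝓝 0)

/-- The orthonormal basis `b`, with origin `p`, is a coordinate system adapted to `E` at `p`: its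
last vector is `(p'' - p') / (2R)`, where `p'`, `p''` are the centres of the touching balls. -/
def IsAdapted {n : ℕ} (R : ℝ) (E : Set (Euc (n + 1))) (p : Euc (n + 1))
    (b : OrthonormalBasis (Fin (n + 1)) ℝ (Euc (n + 1))) : Prop :=
  ∃ p' p'' : Euc (n + 1), IsTouchingPair R E p p' p'' ∧
    b (Fin.last n) = (1 / (2 * R)) • (p'' - p')

/-- The point with coordinates `(x, z)` in the coordinate system with origin `p` and basis `b`. -/
def coordPoint {n : ℕ} (p : Euc (n + 1)) (b : OrthonormalBasis (Fin (n + 1)) ℝ (Euc (n + 1)))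
    (x : Euc n) (z : ℝ) : Euc (n + 1) :=
  p + (∑ i : Fin n, x i • b i.castSucc) + z • b (Fin.last n)

/-- The closed cylinder `{|x| ≤ r} × [-r, r]` in the coordinate system `(p, b)`. -/
def coordCylinder {n : ℕ} (p : Euc (n + 1)) (b : OrthonormalBasis (Fin (n + 1)) ℝ (Euc (n + 1)))
    (r : ℝ) : Set (Euc (n + 1)) :=
  {q | ∃ x ∈ Metric.closedBall (0 : Euc n) r, ∃ z ∈ Set.Icc (-r) r, q = coordPoint p b x z}

/-- The graph of `f` over `{|x| ≤ r}` in the coordinate system `(p, b)`. -/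
def coordGraph {n : ℕ} (p : Euc (n + 1)) (b : OrthonormalBasis (Fin (n + 1)) ℝ (Euc (n + 1)))
    (r : ℝ) (f : Euc n → ℝ) : Set (Euc (n + 1)) :=
  {q | ∃ x ∈ Metric.closedBall (0 : Euc n) r, q = coordPoint p b x (f x)}

/-- `g` is the weak `i`-th partial derivative of `f` on `Ω`. -/
def IsWeakPartial {n : ℕ} (Ω : Set (Euc n)) (i : Fin n) (f g : Euc n → ℝ) : Prop :=
  ∀ φ : Euc n → ℝ, ContDiff ℝ ∞ φ → HasCompactSupport φ → tsupport φ ⊆ Ω →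
    ∫ x in Ω, f x * fderiv ℝ φ x (EuclideanSpace.single i 1) = - ∫ x in Ω, g x * φ x

/-- `f` lies in `W^{2,∞}(Ω)`, with weak gradient `g` and weak Hessian `H`. -/
structure IsW2InftyJet {n : ℕ} (Ω : Set (Euc n)) (f : Euc n → ℝ) (g : Fin n → Euc n → ℝ)
    (H : Fin n → Fin n → Euc n → ℝ) : Prop where
  memLp_fun : MemLp f ⊤ (volume.restrict Ω)
  memLp_grad : ∀ i, MemLp (g i) ⊤ (volume.restrict Ω)
  memLp_hess : ∀ i j, MemLp (H i j) ⊤ (volume.restrict Ω)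
  weak_grad : ∀ i, IsWeakPartial Ω i f (g i)
  weak_hess : ∀ i j, IsWeakPartial Ω j (g i) (H i j)

/-- Membership in the Sobolev space `W^{2,∞}(Ω)`. -/
def MemW2Infty {n : ℕ} (Ω : Set (Euc n)) (f : Euc n → ℝ) : Prop :=
  ∃ g H, IsW2InftyJet Ω f g H

/-- Weak* convergence in `L^∞(Ω) = (L¹(Ω))*`. -/
def WeakStarLInfty {n : ℕ} (Ω : Set (Euc n)) (u : ℕ → Euc n → ℝ) (v : Euc n → ℝ) : Prop :=
  ∀ φ : Euc n → ℝ, Integrable φ (volume.restrict Ω) →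
    Tendsto (fun j => ∫ x in Ω, u j x * φ x) atTop (𝓝 (∫ x in Ω, v x * φ x))

/-- Weak* convergence in `W^{2,∞}(Ω)`: the functions are in `W^{2,∞}(Ω)`, and they and their weak
derivatives of order one and two converge weakly* in `L^∞(Ω)`. -/
def WeakStarW2Infty {n : ℕ} (Ω : Set (Euc n)) (u : ℕ → Euc n → ℝ) (v : Euc n → ℝ) : Prop :=
  ∃ (gu : ℕ → Fin n → Euc n → ℝ) (Hu : ℕ → Fin n → Fin n → Euc n → ℝ)
    (gv : Fin n → Euc n → ℝ) (Hv : Fin n → Fin n → Euc n → ℝ),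
    (∀ j, IsW2InftyJet Ω (u j) (gu j) (Hu j)) ∧ IsW2InftyJet Ω v gv Hv ∧
    WeakStarLInfty Ω u v ∧
    (∀ i, WeakStarLInfty Ω (fun j => gu j i) (gv i)) ∧
    ∀ i k, WeakStarLInfty Ω (fun j => Hu j i k) (Hv i k)

end

open MeasureTheory Filter Topology
open scoped ContDiff ENNReal NNReal

/-! ### Sets with two-sided tangent balls -/

section Thickening

variable {X : Type*} [PseudoMetricSpace X]

/-! The two-sided ball condition is a uniform C^{1,1} bound on the boundary. If `A` lies within `ε`
of `B`, an interior ball of `A` and an exterior ball of `B` have centres at least `2R - 2ε` apart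
(`le_dist_centers`). For `A = B` this makes the unit normal `1/R`-Lipschitz (`mul_norm_sub_le`); for
two close sets it shows that normals at close boundary points are close
(`sub_sq_le_of_subsetThickening`). The balls also confine the boundary to a quadratic neighbourhood
of each tangent plane (`two_mul_abs_inner_le`).

Blaschke selection gives a subsequence converging in the Hausdorff distance, and limits of touching
balls are touching balls of the limit. Boundaries then converge because each normal line of one set
meets the boundary of the other nearby (`exists_add_smul_mem_frontier`). Following these lines
distorts distances by factors tending to 1, in both directions, so the boundary measures converge
(`exists_antilipschitz`). The symmetric difference lies in a shrinking neighbourhood of a null set,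
whence convergence in L¹.

Locally the boundaries are graphs with uniformly Lipschitz gradients `-ν_i / ν_last`. Heights and
gradients converge pointwise and boundedly; Hessians converge weakly* by integration by parts and
density of test functions in L¹. -/

/-- Every point of `A` has distance at most `ε` from some point of `B`. -/
def SubsetThickening (ε : ℝ) (A B : Set X) : Prop :=
  ∀ a ∈ A, ∃ b ∈ B, dist a b ≤ ε

lemma SubsetThickening.refl (A : Set X) : SubsetThickening 0 A A :=
  fun a ha => ⟨a, ha, by simp⟩

end Thickening

section TangentBalls

variable {V : Type*} [NormedAddCommGroup V] [InnerProductSpace ℝ V]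

/-- `ν` is a unit vector such that the balls of radius `R` centred at `p - R ν` and `p + R ν` lie
inside, respectively outside, `E`. -/
structure IsUnitNormal (R : ℝ) (E : Set V) (p ν : V) : Prop where
  norm_eq : ‖ν‖ = 1
  inner_ball : Metric.ball (p - R • ν) R ⊆ E
  outer_ball : ∀ x ∈ E, R ≤ dist x (p + R • ν)

lemma exists_mem_segment_frontier {S : Set V} {a b : V} (ha : a ∈ S) (hb : b ∉ S) :
    ∃ c ∈ segment ℝ a b, c ∈ frontier S := by
  by_contra! h
  have hpre : IsPreconnected (segment ℝ a b) := (convex_segment a b).isPreconnected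
  have hcover : segment ℝ a b ⊆ interior S ∪ (closure S)ᶜ := by
    intro c hc
    by_cases hcS : c ∈ closure S
    · left
      by_contra hci
      exact h c hc ⟨hcS, hci⟩
    · exact Or.inr hcS
  have haI : a ∈ interior S := (hcover (left_mem_segment ℝ a b)).resolve_right
    fun h' => h' (subset_closure ha)
  have hbI : b ∈ (closure S)ᶜ := (hcover (right_mem_segment ℝ a b)).resolve_left
    fun h' => hb (interior_subset h')
  obtain ⟨c, -, hc1, hc2⟩ := hpre _ _ isOpen_interior isClosed_closure.isOpen_compl hcover
    ⟨a, left_mem_segment ℝ a b, haI⟩ ⟨b, right_mem_segment ℝ a b, hbI⟩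
  exact hc2 (subset_closure (interior_subset hc1))

lemma exists_frontier_dist_le {S : Set V} {a b : V} (ha : a ∈ S) (hb : b ∉ S) :
    ∃ c ∈ frontier S, dist a c ≤ dist a b ∧ dist b c ≤ dist a b := by
  obtain ⟨c, hc, hcS⟩ := exists_mem_segment_frontier ha hb
  have := dist_add_dist_of_mem_segment hc
  refine ⟨c, hcS, ?_, ?_⟩
  · linarith [dist_nonneg (x := c) (y := b)]
  · rw [dist_comm b c]; linarith [dist_nonneg (x := a) (y := c)]

/-- Otherwise the midpoint of the centres lies in the interior ball, hence in `A`, and a point of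
`B` within `ε` of it falls into the exterior ball. -/
lemma le_dist_centers {A B : Set V} {R ε : ℝ} {c d : V} (hε : 0 ≤ ε)
    (hc : Metric.ball c R ⊆ A) (hd : ∀ x ∈ B, R ≤ dist x d) (hAB : SubsetThickening ε A B) :
    2 * R - 2 * ε ≤ dist c d := by
  by_contra! h
  have h1 : dist (midpoint ℝ c d) c = dist c d / 2 := by
    rw [dist_midpoint_left]; norm_num; ring
  have h2 : dist (midpoint ℝ c d) d = dist c d / 2 := by
    rw [dist_midpoint_right]; norm_num; ring
  obtain ⟨b, hb, hmb⟩ := hAB _ (hc (show midpoint ℝ c d ∈ Metric.ball c R by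
    rw [Metric.mem_ball, h1]; linarith))
  have := hd b hb
  have := dist_triangle_left b d (midpoint ℝ c d)
  linarith

namespace IsUnitNormal

variable {R ε : ℝ} {A B : Set V} {p q ν μ : V}

/-- The centres `p - Rν` and `q + Rμ` are almost `2R` apart, so `‖ν + μ‖` is almost 2, and the
parallelogram law makes `ν - μ` small. Only a square-root modulus results, but the two normals may
belong to different sets. -/
lemma sub_sq_le_of_subsetThickening (hR : 0 < R) (hε : 0 ≤ ε) (hA : IsUnitNormal R A p ν)
    (hB : IsUnitNormal R B q μ) (hAB : SubsetThickening ε A B) :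
    R * ‖ν - μ‖ ^ 2 ≤ 4 * (‖p - q‖ + 2 * ε) := by
  have h := le_dist_centers hε hA.inner_ball hB.outer_ball hAB
  rw [dist_eq_norm] at h
  have h1 : ‖p - R • ν - (q + R • μ)‖ ≤ ‖p - q‖ + R * ‖ν + μ‖ := by
    have : p - R • ν - (q + R • μ) = (p - q) - R • (ν + μ) := by module
    rw [this]
    refine (norm_sub_le _ _).trans ?_
    rw [norm_smul, Real.norm_of_nonneg hR.le]
  have h2 : ‖ν + μ‖ ^ 2 + ‖ν - μ‖ ^ 2 = 4 := by
    have := parallelogram_law_with_norm ℝ ν μ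
    rw [hA.norm_eq, hB.norm_eq] at this
    nlinarith
  have h0 := norm_nonneg (ν + μ)
  have h3 : ‖ν + μ‖ ≤ 2 := by nlinarith [sq_nonneg ‖ν - μ‖]
  have h4 : 2 * R - (‖p - q‖ + 2 * ε) ≤ R * ‖ν + μ‖ := by linarith
  have h5 : R * ‖ν - μ‖ ^ 2 = R * ((2 - ‖ν + μ‖) * (2 + ‖ν + μ‖)) := by
    have : ‖ν - μ‖ ^ 2 = (2 - ‖ν + μ‖) * (2 + ‖ν + μ‖) := by linarith
    rw [this]
  rw [h5]
  have h6 : R * (2 - ‖ν + μ‖) ≤ ‖p - q‖ + 2 * ε := by linarith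
  have h7 : 0 ≤ R * (2 - ‖ν + μ‖) := mul_nonneg hR.le (by linarith)
  nlinarith

/-- With a single set both pairs of opposite balls are available. On adding the squares of the two
centre distances the mixed terms cancel, which upgrades the square-root modulus to a Lipschitz
bound. The case `p = q` is uniqueness of the normal. -/
lemma mul_norm_sub_le (hR : 0 < R) (hp : IsUnitNormal R A p ν) (hq : IsUnitNormal R A q μ) :
    R * ‖ν - μ‖ ≤ ‖p - q‖ := by
  have h1 := le_dist_centers le_rfl hp.inner_ball hq.outer_ball (.refl A)
  have h2 := le_dist_centers le_rfl hq.inner_ball hp.outer_ball (.refl A)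
  rw [dist_eq_norm] at h1 h2
  have e1 : p - R • ν - (q + R • μ) = (p - q) - R • (ν + μ) := by module
  have e2 : q - R • μ - (p + R • ν) = -((p - q) + R • (ν + μ)) := by module
  rw [e1] at h1
  rw [e2, norm_neg] at h2
  have h3 := parallelogram_law_with_norm ℝ (p - q) (R • (ν + μ))
  have h4 := parallelogram_law_with_norm ℝ ν μ
  rw [hp.norm_eq, hq.norm_eq] at h4
  rw [norm_smul, Real.norm_of_nonneg hR.le] at h3
  refine (abs_le_of_sq_le_sq' ?_ (norm_nonneg _)).2
  have h5 : (2 * R) ^ 2 ≤ ‖p - q - R • (ν + μ)‖ ^ 2 := by gcongr; linarith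
  have h6 : (2 * R) ^ 2 ≤ ‖p - q + R • (ν + μ)‖ ^ 2 := by gcongr; linarith
  have h7 : R ^ 2 * (‖ν + μ‖ ^ 2 + ‖ν - μ‖ ^ 2) = R ^ 2 * 4 := by rw [h4]; norm_num
  nlinarith

/-- The boundary separates quadratically from the tangent plane. -/
lemma two_mul_abs_inner_le (hR : 0 < R) (hp : IsUnitNormal R A p ν) (hq : q ∈ frontier A) :
    2 * R * |inner ℝ (q - p) ν| ≤ ‖q - p‖ ^ 2 := by
  have h1 : R ≤ ‖(q - p) + R • ν‖ := by
    by_contra! h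
    refine hq.2 (interior_maximal hp.inner_ball Metric.isOpen_ball ?_)
    rwa [Metric.mem_ball, dist_eq_norm, show q - (p - R • ν) = (q - p) + R • ν by module]
  have h2 : R ≤ ‖(q - p) - R • ν‖ := by
    have hcl : IsClosed {x : V | R ≤ dist x (p + R • ν)} :=
      isClosed_le continuous_const (by fun_prop)
    have : R ≤ dist q (p + R • ν) := closure_minimal hp.outer_ball hcl hq.1
    rwa [dist_eq_norm, show q - (p + R • ν) = (q - p) - R • ν by module] at this
  have e1 := norm_add_sq_real (q - p) (R • ν)
  have e2 := norm_sub_sq_real (q - p) (R • ν)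
  rw [inner_smul_right, norm_smul, hp.norm_eq, Real.norm_of_nonneg hR.le] at e1 e2
  rcases abs_cases (inner ℝ (q - p) ν) with ⟨h, -⟩ | ⟨h, -⟩ <;> rw [h] <;> nlinarith

lemma le_dist_add_smul (hp : IsUnitNormal R A p ν) {t : ℝ} (htR : t ≤ R)
    {a : V} (ha : a ∈ A) : t ≤ dist (p + t • ν) a := by
  have h1 := hp.outer_ball _ ha
  have h2 := dist_triangle_left a (p + R • ν) (p + t • ν)
  rw [dist_eq_norm (p + t • ν) (p + R • ν),
    show p + t • ν - (p + R • ν) = (t - R) • ν by module, norm_smul, hp.norm_eq,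
    mul_one, Real.norm_eq_abs, abs_of_nonpos (by linarith)] at h2
  linarith

lemma mem_of_dist_sub_smul_lt (hp : IsUnitNormal R A p ν) {t : ℝ} (htR : t ≤ R)
    {a : V} (ha : dist a (p - t • ν) < t) : a ∈ A := by
  refine hp.inner_ball ?_
  have h2 := dist_triangle a (p - t • ν) (p - R • ν)
  rw [dist_eq_norm (p - t • ν) (p - R • ν),
    show p - t • ν - (p - R • ν) = (R - t) • ν by module, norm_smul, hp.norm_eq,
    mul_one, Real.norm_eq_abs, abs_of_nonneg (by linarith)] at h2
  rw [Metric.mem_ball]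
  linarith

/-- The normal line at a boundary point of `A` meets the boundary of a close set `B`. -/
lemma exists_add_smul_mem_frontier (hε : 0 < ε) (hεR : 4 * ε ≤ R)
    (hp : IsUnitNormal R A p ν) (hAB : SubsetThickening ε A B) (hBA : SubsetThickening ε B A)
    (hB : ∀ q ∈ frontier B, ∃ μ, IsUnitNormal R B q μ) :
    ∃ t : ℝ, |t| ≤ 4 * ε ∧ p + t • ν ∈ frontier B := by
  -- This point is at distance at least `4ε` from `A`, whereas `B` lies within `ε` of `A`.
  have hout : p + (4 * ε) • ν ∉ B := by
    intro h
    obtain ⟨a, ha, hxa⟩ := hBA _ h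
    have := hp.le_dist_add_smul hεR ha
    linarith
  -- If not, some `c ∈ ∂B` is within `ε` of this point. Pushing `c` outwards by `2ε` gives a point
  -- at distance at least `2ε` from `B`, yet at most `3ε < 4ε` from the centre of an inner ball of
  -- `A`, hence in `A`: this contradicts that `A` is within `ε` of `B`.
  have hin : p - (4 * ε) • ν ∈ B := by
    by_contra h
    have hA : p - (4 * ε) • ν ∈ A := hp.mem_of_dist_sub_smul_lt hεR (by simpa using hε)
    obtain ⟨b, hb, hxb⟩ := hAB _ hA
    obtain ⟨c, hc, -, hxc⟩ := exists_frontier_dist_le hb h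
    obtain ⟨μ, hμ⟩ := hB c hc
    have hy : c + (2 * ε) • μ ∈ A := by
      refine hp.mem_of_dist_sub_smul_lt hεR ?_
      have h1 := dist_triangle_right (c + (2 * ε) • μ) (p - (4 * ε) • ν) c
      have h2 : dist (c + (2 * ε) • μ) c = 2 * ε := by
        rw [dist_eq_norm, add_sub_cancel_left, norm_smul, hμ.norm_eq,
          Real.norm_of_nonneg (by positivity), mul_one]
      rw [dist_comm b] at hxc
      linarith
    obtain ⟨b', hb', hyb⟩ := hAB _ hy
    have := hμ.le_dist_add_smul (t := 2 * ε) (by linarith) hb'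
    linarith
  obtain ⟨c, hc, hcB⟩ := exists_mem_segment_frontier hin hout
  rw [segment_eq_image'] at hc
  obtain ⟨θ, ⟨h0, h1⟩, rfl⟩ := hc
  refine ⟨θ * (8 * ε) - 4 * ε, abs_le.2 ⟨by nlinarith, by nlinarith⟩, ?_⟩
  convert hcB using 1
  module

end IsUnitNormal

/-- `N` assigns to every boundary point of `A` a unit normal. -/
def IsNormalField (R : ℝ) (A : Set V) (N : V → V) : Prop :=
  ∀ p ∈ frontier A, IsUnitNormal R A p (N p)

variable {R ε : ℝ} {A B : Set V} {N M : V → V}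

lemma IsNormalField.exists_frontier_dist_le (hN : IsNormalField R A N) (hM : IsNormalField R B M)
    (hε : 0 < ε) (hεR : 4 * ε ≤ R) (hAB : SubsetThickening ε A B) (hBA : SubsetThickening ε B A) :
    SubsetThickening (4 * ε) (frontier A) (frontier B) := by
  intro p hp
  obtain ⟨t, ht, htB⟩ := (hN p hp).exists_add_smul_mem_frontier hε hεR hAB hBA
    fun q hq => ⟨M q, hM q hq⟩
  refine ⟨_, htB, ?_⟩
  rwa [dist_self_add_right, norm_smul, (hN p hp).norm_eq, mul_one, Real.norm_eq_abs]

set_option maxHeartbeats 800000 in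
/-- Close sets have boundaries that are related by a map with almost non-increasing inverse. -/
lemma IsNormalField.exists_antilipschitz (hR : 0 < R) {σ : ℝ} (hσ : 0 < σ) (hσ1 : 22 * σ < 1)
    (hN : IsNormalField R A N) (hM : IsNormalField R B M)
    (hAB : SubsetThickening (σ ^ 2 * R) A B) (hBA : SubsetThickening (σ ^ 2 * R) B A) :
    ∃ φ : V → V, ∀ p ∈ frontier A, φ p ∈ frontier B ∧ ∀ q ∈ frontier A,
      dist p q ≤ (1 + 22 * σ) / (1 - 22 * σ) * dist (φ p) (φ q) := by
  have hε : 0 < σ ^ 2 * R := by positivity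
  have hσ2 : 4 * σ ^ 2 ≤ 1 := by nlinarith
  have hεR : 4 * (σ ^ 2 * R) ≤ R := by nlinarith
  have hex : ∀ p, ∃ t : ℝ, p ∈ frontier A → |t| ≤ 4 * (σ ^ 2 * R) ∧ p + t • N p ∈ frontier B := by
    intro p
    by_cases hp : p ∈ frontier A
    · obtain ⟨t, ht⟩ := (hN p hp).exists_add_smul_mem_frontier hε hεR hAB hBA
        fun q hq => ⟨M q, hM q hq⟩
      exact ⟨t, fun _ => ht⟩
    · exact ⟨0, fun h => absurd h hp⟩
  choose t ht using hex
  -- The map follows the normal of `A` until it hits the boundary of `B`.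
  refine ⟨fun p => p + t p • N p, fun p hp => ⟨(ht p hp).2, fun q hq => ?_⟩⟩
  obtain ⟨htp, hpB⟩ := ht p hp
  obtain ⟨htq, hqB⟩ := ht q hq
  set p' := p + t p • N p with hp'
  set q' := q + t q • N q with hq'
  have hNp := hN p hp
  have hNq := hN q hq
  have e0 : q' - p' = (q - p) - (t p - t q) • N p - t q • (N p - N q) := by
    rw [hp', hq']; module
  have hLip : R * ‖N p - N q‖ ≤ ‖q - p‖ := by
    rw [norm_sub_rev q p]; exact hNp.mul_norm_sub_le hR hNq
  have h1 := hNp.two_mul_abs_inner_le hR hq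
  have h2 := (hM p' hpB).two_mul_abs_inner_le hR hqB
  have h3 := hNp.sub_sq_le_of_subsetThickening hR hε.le (hM p' hpB) hAB
  have hpp' : ‖p - p'‖ ≤ 4 * (σ ^ 2 * R) := by
    rwa [hp', sub_add_cancel_left, norm_neg, norm_smul, hNp.norm_eq, mul_one, Real.norm_eq_abs]
  have hqq' : ‖q - q'‖ ≤ 4 * (σ ^ 2 * R) := by
    rwa [hq', sub_add_cancel_left, norm_neg, norm_smul, hNq.norm_eq, mul_one, Real.norm_eq_abs]
  -- With `ε = σ²R` the squared difference is at most `4(4ε + 2ε)/R = 24σ²`; the choice of `ε` makes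
  -- the error linear in `σ`.
  have h4 : ‖N p - M p'‖ ≤ 5 * σ := by
    refine (abs_le_of_sq_le_sq' ?_ (by positivity)).2
    have : R * ‖N p - M p'‖ ^ 2 ≤ R * (5 * σ) ^ 2 := by nlinarith
    exact le_of_mul_le_mul_left this hR
  set P := ‖q - p‖ with hP
  set Q := ‖q' - p'‖ with hQ
  have hP0 : 0 ≤ P := norm_nonneg _
  have hQ0 : 0 ≤ Q := norm_nonneg _
  have hfar : |P - Q| ≤ 8 * (σ ^ 2 * R) := by
    have h := abs_norm_sub_norm_le (q - p) (q' - p')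
    rw [show q - p - (q' - p') = (q - q') - (p - p') by abel] at h
    exact h.trans ((norm_sub_le _ _).trans (by linarith))
  -- For points at least `σR` apart, the displacement `8σ²R` is at most `8σP`. For closer points, `t
  -- p - t q` is read off the `N p`-component of `q' - p'`, where both chords are almost tangential.
  -- Either way the error is at most `9σ(P + Q)`; 22 leaves slack.
  have hkey : |P - Q| ≤ 22 * σ * (P + Q) := by
    rcases le_or_gt (σ * R) P with hPs | hPs
    · refine hfar.trans ?_
      have : σ * (σ * R) ≤ σ * P := by gcongr
      linarith [mul_nonneg hσ.le hQ0, mul_nonneg hσ.le hP0]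
    · have hT : ‖t q • (N p - N q)‖ ≤ 4 * σ ^ 2 * P := by
        rw [norm_smul, Real.norm_eq_abs]
        calc |t q| * ‖N p - N q‖ ≤ 4 * (σ ^ 2 * R) * ‖N p - N q‖ := by gcongr
          _ = 4 * σ ^ 2 * (R * ‖N p - N q‖) := by ring
          _ ≤ _ := by gcongr
      have hI : |inner ℝ (q' - p') (N p)| ≤ |inner ℝ (q' - p') (M p')| + Q * (5 * σ) := by
        have e : inner ℝ (q' - p') (N p) =
            inner ℝ (q' - p') (M p') + inner ℝ (q' - p') (N p - M p') := by
          rw [← inner_add_right]; congr 1; abel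
        rw [e]
        refine (abs_add_le _ _).trans ?_
        gcongr
        exact (abs_real_inner_le_norm _ _).trans (by gcongr)
      have hI2 : |inner ℝ (t q • (N p - N q)) (N p)| ≤ 4 * σ ^ 2 * P := by
        refine (abs_real_inner_le_norm _ _).trans ?_
        rwa [hNp.norm_eq, mul_one]
      have e1 : t p - t q = inner ℝ (q - p) (N p) - inner ℝ (t q • (N p - N q)) (N p)
          - inner ℝ (q' - p') (N p) := by
        rw [e0, inner_sub_left (q - p - _), inner_sub_left (q - p), real_inner_smul_left (N p),
          real_inner_self_eq_norm_sq, hNp.norm_eq]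
        ring
      have h5 : |inner ℝ (q - p) (N p)| ≤ σ * P := by
        have : 2 * R * |inner ℝ (q - p) (N p)| ≤ 2 * R * (σ * P) := by nlinarith
        exact le_of_mul_le_mul_left this (by positivity)
      have hQs : Q ≤ 2 * (σ * R) := by
        have h := (abs_le.1 hfar).1
        have : 8 * σ * (σ * R) ≤ 1 * (σ * R) := by gcongr; linarith
        linarith
      have h6 : |inner ℝ (q' - p') (M p')| ≤ σ * Q := by
        have : 2 * R * |inner ℝ (q' - p') (M p')| ≤ 2 * R * (σ * Q) := by nlinarith
        exact le_of_mul_le_mul_left this (by positivity)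
      have h7 : |t p - t q| ≤ 6 * σ * Q + (σ + 4 * σ ^ 2) * P := by
        rw [e1]
        refine (abs_sub _ _).trans ((add_le_add_left (abs_sub _ _) _).trans ?_)
        linarith
      have h8 : |P - Q| ≤ |t p - t q| + 4 * σ ^ 2 * P := by
        have h := abs_norm_sub_norm_le (q - p) (q' - p')
        rw [show q - p - (q' - p') = (t p - t q) • N p + t q • (N p - N q) by rw [e0]; abel] at h
        refine h.trans ((norm_add_le _ _).trans ?_)
        rw [norm_smul, hNp.norm_eq, mul_one, Real.norm_eq_abs]
        gcongr
      have h9 : σ ^ 2 ≤ σ := by nlinarith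
      have h10 : σ ^ 2 * P ≤ σ * P := by gcongr
      linarith [mul_nonneg hσ.le hQ0, mul_nonneg hσ.le hP0]
  rw [dist_comm p q, dist_comm p' q', dist_eq_norm, dist_eq_norm, div_mul_eq_mul_div,
    le_div_iff₀ (by linarith)]
  linarith [(abs_le.1 hkey).2]

end TangentBalls

/-! ### The class of sets with two-sided tangent balls -/

section ClassU

variable {n : ℕ} {R : ℝ} {E : Set (Euc n)}

/-- The centres are at least `2R` apart while both have distance `R` from `p`; equality in the
triangle inequality makes `p` their midpoint. -/
lemma IsTouchingPair.isUnitNormal (hR : 0 < R) {p p' p'' : Euc n}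
    (h : IsTouchingPair R E p p' p'') : IsUnitNormal R E p ((1 / (2 * R)) • (p'' - p')) := by
  obtain ⟨h1, h2, h3, h4⟩ := h
  have hout : ∀ x ∈ E, R ≤ dist x p'' := fun x hx => by
    by_contra! hlt
    exact (Set.eq_empty_iff_forall_notMem.1 h4 x) ⟨hlt, hx⟩
  have hd := le_dist_centers le_rfl h3 hout (.refl E)
  rw [mem_sphere_iff_norm] at h1 h2
  have e1 : p' - p'' = -((p - p') + (p'' - p)) := by abel
  rw [dist_eq_norm, e1, norm_neg] at hd
  have hpar := parallelogram_law_with_norm ℝ (p - p') (p'' - p)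
  rw [h1, norm_sub_rev p'' p, h2] at hpar
  have hsq : (2 * R) ^ 2 ≤ ‖p - p' + (p'' - p)‖ ^ 2 := by gcongr; linarith
  have h0 : ‖p - p' - (p'' - p)‖ ^ 2 = 0 := le_antisymm (by nlinarith) (sq_nonneg _)
  have h5 : p'' - p = p - p' := (sub_eq_zero.1 (norm_eq_zero.1 (pow_eq_zero_iff two_ne_zero |>.1 h0))).symm
  have h6 : (1 / (2 * R)) • (p'' - p') = (1 / R) • (p - p') := by
    rw [show p'' - p' = (2 : ℝ) • (p - p') by
      rw [show p'' - p' = (p'' - p) + (p - p') by abel, h5, two_smul], smul_smul]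
    congr 1; field_simp
  have h7 : R • (1 / (2 * R)) • (p'' - p') = p - p' := by
    rw [h6, smul_smul, mul_one_div_cancel hR.ne', one_smul]
  refine ⟨?_, ?_, ?_⟩
  · rw [h6, norm_smul, h1, Real.norm_of_nonneg (by positivity), one_div_mul_cancel hR.ne']
  · rwa [h7, sub_sub_cancel]
  · rw [h7, ← h5, add_sub_cancel]
    exact hout

lemma IsUnitNormal.isTouchingPair (hR : 0 < R) {p ν : Euc n} (h : IsUnitNormal R E p ν) :
    IsTouchingPair R E p (p - R • ν) (p + R • ν) := by
  refine ⟨?_, ?_, h.inner_ball, ?_⟩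
  · simp [mem_sphere_iff_norm, norm_smul, h.norm_eq, hR.le]
  · simp [mem_sphere_iff_norm, norm_smul, h.norm_eq, hR.le]
  · rw [Set.eq_empty_iff_forall_notMem]
    rintro x ⟨hx, hxE⟩
    exact absurd (h.outer_ball x hxE) (not_le.2 hx)

lemma exists_isNormalField (hR : 0 < R) (hE : E ∈ classU n R) : ∃ N, IsNormalField R E N := by
  have : ∀ p, ∃ ν, p ∈ frontier E → IsUnitNormal R E p ν := by
    intro p
    by_cases hp : p ∈ frontier E
    · obtain ⟨p', p'', h⟩ := hE.2.2 p hp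
      exact ⟨_, fun _ => h.isUnitNormal hR⟩
    · exact ⟨0, fun h => absurd h hp⟩
  choose N hN using this
  exact ⟨N, hN⟩

end ClassU

/-! ### Kuratowski convergence -/

lemma kuratowskiTendsto_of_subsetThickening {n : ℕ} {E : ℕ → Set (Euc n)} {L : Set (Euc n)}
    (hL : IsClosed L) {ε : ℕ → ℝ} (hε : Tendsto ε atTop (𝓝 0))
    (h1 : ∀ j, SubsetThickening (ε j) (E j) L) (h2 : ∀ j, SubsetThickening (ε j) L (E j)) :
    KuratowskiTendsto E L := by
  constructor
  · intro k q p hk hq hqp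
    choose b hb hqb using fun i => h1 (k i) (q i) (hq i)
    have h0 : Tendsto (fun i => dist (q i) (b i)) atTop (𝓝 0) :=
      squeeze_zero (fun _ => dist_nonneg) hqb (hε.comp hk.tendsto_atTop)
    exact hL.mem_of_tendsto (hqp.congr_dist h0) (Eventually.of_forall hb)
  · intro p hp
    choose q hq hpq using fun j => h2 j p hp
    refine ⟨q, hq, ?_⟩
    rw [tendsto_iff_dist_tendsto_zero]
    exact squeeze_zero (fun _ => dist_nonneg) (fun j => by rw [dist_comm]; exact hpq j) hε

/-! ### Hausdorff measure of boundaries -/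

section Measure

lemma hausdorffMeasure_le_of_antilipschitzOn {X Y : Type*} [MetricSpace X] [MeasurableSpace X]
    [BorelSpace X] [MetricSpace Y] [MeasurableSpace Y] [BorelSpace Y] {s : Set X} {t : Set Y}
    {φ : X → Y} {K d : ℝ} (hd : 0 ≤ d) (hmaps : ∀ p ∈ s, φ p ∈ t)
    (h : ∀ p ∈ s, ∀ q ∈ s, dist p q ≤ K * dist (φ p) (φ q)) :
    Measure.hausdorffMeasure d s ≤ ENNReal.ofReal K ^ d * Measure.hausdorffMeasure d t := by
  have hanti : AntilipschitzWith K.toNNReal (fun p : s => φ p) := by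
    refine AntilipschitzWith.of_le_mul_dist fun p q => ?_
    refine (h p p.2 q q.2).trans ?_
    gcongr
    exact Real.le_coe_toNNReal K
  have h1 := hanti.le_hausdorffMeasure_image hd Set.univ
  have h2 : Measure.hausdorffMeasure d s = Measure.hausdorffMeasure d (Set.univ : Set s) := by
    rw [← isometry_subtype_coe.hausdorffMeasure_image (Or.inl hd) (Set.univ : Set s),
      Set.image_univ, Subtype.range_coe]
  rw [h2]
  refine h1.trans ?_
  gcongr
  · rfl
  · rintro _ ⟨p, -, rfl⟩
    exact hmaps p p.2

/-- In the sup norm the `n`-dimensional Hausdorff measure is Lebesgue measure, and passing to the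
Euclidean norm is bi-Lipschitz. -/
lemma hausdorffMeasure_lt_top_of_isBounded {n : ℕ} {s : Set (Euc n)}
    (hs : Bornology.IsBounded s) : Measure.hausdorffMeasure (n : ℝ) s < ⊤ := by
  have h1 := (PiLp.antilipschitzWith_ofLp 2 (fun _ : Fin n => ℝ)).le_hausdorffMeasure_image
    (Nat.cast_nonneg n) s
  have h2 := hausdorffMeasure_pi_real (ι := Fin n)
  rw [Fintype.card_fin] at h2
  rw [h2] at h1
  refine h1.trans_lt (ENNReal.mul_lt_top (ENNReal.rpow_lt_top_of_nonneg (by positivity) (by simp)) ?_)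
  exact ((PiLp.lipschitzWith_ofLp 2 (fun _ : Fin n => ℝ)).isBounded_image hs).measure_lt_top

lemma volume_eq_zero_of_hausdorffMeasure_lt_top {n : ℕ} {s : Set (Euc (n + 1))}
    (hs : Measure.hausdorffMeasure (n : ℝ) s < ⊤) : volume s = 0 := by
  have h0 : Measure.hausdorffMeasure ((n + 1 : ℕ) : ℝ) s = 0 :=
    (Measure.hausdorffMeasure_zero_or_top (by push_cast; linarith) s).resolve_right hs.ne
  have h1 := (PiLp.lipschitzWith_ofLp 2 (fun _ : Fin (n + 1) => ℝ)).hausdorffMeasure_image_le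
    (Nat.cast_nonneg (n + 1)) s
  have h2 := hausdorffMeasure_pi_real (ι := Fin (n + 1))
  rw [Fintype.card_fin] at h2
  rw [h2, h0, mul_zero, nonpos_iff_eq_zero] at h1
  rw [← (PiLp.volume_preserving_ofLp (Fin (n + 1))).measure_preimage
    (NullMeasurableSet.of_null h1)] at h1
  exact measure_mono_null (Set.subset_preimage_image _ _) h1

variable {n : ℕ} {R : ℝ} {A : Set (Euc (n + 1))} {N : Euc (n + 1) → Euc (n + 1)}

/-- Projection to the tangent hyperplane at `p` is injective with 2-Lipschitz inverse here: the `N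
p`-component of a chord is at most a quarter of its length, one eighth from quadratic tangency and
one eighth from the variation of the normal. -/
lemma IsNormalField.hausdorffMeasure_inter_ball_lt_top (hR : 0 < R) (hN : IsNormalField R A N)
    {p : Euc (n + 1)} (hp : p ∈ frontier A) :
    Measure.hausdorffMeasure (n : ℝ) (frontier A ∩ Metric.ball p (R / 8)) < ⊤ := by
  have hν := (hN p hp).norm_eq
  have hν0 : N p ≠ 0 := by
    intro h
    rw [h, norm_zero] at hν
    exact zero_ne_one hν
  have : Fact (Module.finrank ℝ (Euc (n + 1)) = n + 1) := ⟨by simp⟩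
  have hfin : Module.finrank ℝ (ℝ ∙ (N p))ᗮ = n := Submodule.finrank_orthogonal_span_singleton hν0
  let e : (ℝ ∙ (N p))ᗮ ≃ₗᵢ[ℝ] Euc n :=
    ((stdOrthonormalBasis ℝ (ℝ ∙ (N p))ᗮ).reindex (finCongr hfin)).repr
  let φ : Euc (n + 1) → Euc n := fun q => e ((ℝ ∙ (N p))ᗮ.orthogonalProjectionOnto q)
  have hφ : ∀ q q', ‖q - q'‖ ≤ ‖φ q - φ q'‖ + |inner ℝ (q - q') (N p)| := by
    intro q q'
    have h1 : ‖φ q - φ q'‖ = ‖(ℝ ∙ (N p))ᗮ.starProjection (q - q')‖ := by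
      simp only [φ]
      rw [← map_sub, e.norm_map, ← map_sub]
      rfl
    have h2 : q - q' = (ℝ ∙ (N p))ᗮ.starProjection (q - q')
        + (inner ℝ (N p) (q - q') : ℝ) • N p := by
      rw [Submodule.starProjection_orthogonal_val, Submodule.starProjection_unit_singleton ℝ hν]
      abel
    rw [h1]
    conv_lhs => rw [h2]
    refine (norm_add_le _ _).trans ?_
    rw [norm_smul, hν, mul_one, Real.norm_eq_abs, real_inner_comm]
  have hφL : LipschitzWith 1 φ := e.lipschitz.comp ((ℝ ∙ (N p))ᗮ.lipschitzWith_orthogonalProjectionOnto) |>.weaken (by simp)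
  have hb : Bornology.IsBounded (φ '' Metric.ball p (R / 8)) := hφL.isBounded_image Metric.isBounded_ball
  have hle := hausdorffMeasure_le_of_antilipschitzOn (s := frontier A ∩ Metric.ball p (R / 8))
    (φ := φ) (K := 2) (d := n) (Nat.cast_nonneg n)
    (fun q hq => Set.mem_image_of_mem φ hq.2) ?_
  · exact hle.trans_lt (ENNReal.mul_lt_top (ENNReal.rpow_lt_top_of_nonneg (by positivity) (by simp))
      (hausdorffMeasure_lt_top_of_isBounded hb))
  · rintro q ⟨hq, hqp⟩ q' ⟨hq', hqp'⟩
    rw [dist_eq_norm, dist_eq_norm]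
    have h1 := hφ q q'
    have h2 := (hN q' hq').two_mul_abs_inner_le hR hq
    have h3 := (hN p hp).mul_norm_sub_le hR (hN q' hq')
    rw [mem_ball_iff_norm] at hqp hqp'
    rw [norm_sub_rev p q'] at h3
    have h4 : ‖N p - N q'‖ ≤ 1 / 8 := by
      have : R * ‖N p - N q'‖ ≤ R * (1 / 8) := by linarith
      exact le_of_mul_le_mul_left this hR
    have h5 : ‖q - q'‖ ≤ R / 4 := by
      rw [show q - q' = (q - p) - (q' - p) by abel]
      exact (norm_sub_le _ _).trans (by linarith)
    have h6 : |inner ℝ (q - q') (N q')| ≤ 1 / 8 * ‖q - q'‖ := by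
      have : 2 * R * |inner ℝ (q - q') (N q')| ≤ 2 * R * (1 / 8 * ‖q - q'‖) := by
        nlinarith [norm_nonneg (q - q')]
      exact le_of_mul_le_mul_left this (by positivity)
    have h7 : |inner ℝ (q - q') (N p)| ≤ 1 / 8 * ‖q - q'‖ + ‖q - q'‖ * (1 / 8) := by
      have e : inner ℝ (q - q') (N p) =
          inner ℝ (q - q') (N q') + inner ℝ (q - q') (N p - N q') := by
        rw [← inner_add_right]; congr 1; abel
      rw [e]
      refine (abs_add_le _ _).trans (add_le_add h6 ?_)
      exact (abs_real_inner_le_norm _ _).trans (by gcongr)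
    linarith [norm_nonneg (q - q')]

lemma IsNormalField.hausdorffMeasure_frontier_lt_top (hR : 0 < R) (hN : IsNormalField R A N)
    (hA : IsCompact A) : Measure.hausdorffMeasure (n : ℝ) (frontier A) < ⊤ := by
  have hc : IsCompact (frontier A) := hA.of_isClosed_subset isClosed_frontier hA.isClosed.frontier_subset
  refine hc.measure_lt_top_of_nhdsWithin fun p hp => ?_
  refine ⟨frontier A ∩ Metric.ball p (R / 8), ?_, hN.hausdorffMeasure_inter_ball_lt_top hR hp⟩
  exact inter_mem_nhdsWithin _ (Metric.ball_mem_nhds p (by positivity))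

/-- `exists_antilipschitz`, applied in both directions, squeezes the measures between multiples of
the limit with factors tending to 1. -/
lemma tendsto_hausdorffMeasure_frontier (hR : 0 < R) {E : ℕ → Set (Euc (n + 1))}
    {L : Set (Euc (n + 1))} (hE : ∀ j, ∃ N, IsNormalField R (E j) N)
    (hL : ∃ N, IsNormalField R L N)
    {σ : ℕ → ℝ} (hσ : ∀ j, 0 < σ j) (hσ1 : ∀ j, 22 * σ j < 1) (hσ0 : Tendsto σ atTop (𝓝 0))
    (h1 : ∀ j, SubsetThickening (σ j ^ 2 * R) (E j) L)
    (h2 : ∀ j, SubsetThickening (σ j ^ 2 * R) L (E j)) :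
    Tendsto (fun j => Measure.hausdorffMeasure (n : ℝ) (frontier (E j))) atTop
      (𝓝 (Measure.hausdorffMeasure (n : ℝ) (frontier L))) := by
  obtain ⟨M, hM⟩ := hL
  set K : ℕ → ℝ≥0∞ := fun j => ENNReal.ofReal ((1 + 22 * σ j) / (1 - 22 * σ j)) ^ (n : ℝ) with hK
  have hKpos : ∀ j, 0 < (1 + 22 * σ j) / (1 - 22 * σ j) := fun j =>
    div_pos (by linarith [hσ j]) (by linarith [hσ1 j])
  have hK1 : Tendsto K atTop (𝓝 1) := by
    have h : Tendsto (fun j => (1 + 22 * σ j) / (1 - 22 * σ j)) atTop (𝓝 1) := by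
      have h := ((hσ0.const_mul 22).const_add 1).div ((hσ0.const_mul 22).const_sub 1)
        (by norm_num)
      rw [mul_zero, add_zero, sub_zero, div_one] at h
      exact h
    have := ((ENNReal.continuous_ofReal.tendsto 1).comp h)
    rw [ENNReal.ofReal_one] at this
    have := (ENNReal.continuous_rpow_const (y := (n : ℝ))).tendsto 1 |>.comp this
    rwa [ENNReal.one_rpow] at this
  have hu : ∀ j, Measure.hausdorffMeasure (n : ℝ) (frontier (E j)) ≤
      K j * Measure.hausdorffMeasure (n : ℝ) (frontier L) := fun j => by
    obtain ⟨N, hN⟩ := hE j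
    obtain ⟨φ, hφ⟩ := hN.exists_antilipschitz hR (hσ j) (hσ1 j) hM (h1 j) (h2 j)
    exact hausdorffMeasure_le_of_antilipschitzOn (Nat.cast_nonneg n) (fun p hp => (hφ p hp).1)
      fun p hp => (hφ p hp).2
  have hl : ∀ j, (K j)⁻¹ * Measure.hausdorffMeasure (n : ℝ) (frontier L) ≤
      Measure.hausdorffMeasure (n : ℝ) (frontier (E j)) := fun j => by
    obtain ⟨N, hN⟩ := hE j
    obtain ⟨φ, hφ⟩ := hM.exists_antilipschitz hR (hσ j) (hσ1 j) hN (h2 j) (h1 j)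
    have := hausdorffMeasure_le_of_antilipschitzOn (d := n) (Nat.cast_nonneg n) (fun p hp => (hφ p hp).1)
      fun p hp => (hφ p hp).2
    rw [mul_comm, ← div_eq_mul_inv]
    exact ENNReal.div_le_of_le_mul' this
  have hmul : ∀ c : ℕ → ℝ≥0∞, Tendsto c atTop (𝓝 1) →
      Tendsto (fun j => c j * Measure.hausdorffMeasure (n : ℝ) (frontier L)) atTop
        (𝓝 (Measure.hausdorffMeasure (n : ℝ) (frontier L))) := fun c hc => by
    have := ENNReal.Tendsto.mul_const (b := Measure.hausdorffMeasure (n : ℝ) (frontier L)) hc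
      (Or.inl one_ne_zero)
    rwa [one_mul] at this
  refine tendsto_of_tendsto_of_tendsto_of_le_of_le (hmul _ ?_) (hmul _ hK1) hl hu
  have := tendsto_inv_iff.2 hK1
  rwa [inv_one] at this

/-! ### Convergence in `L¹` -/

/-- The symmetric difference lies in the closed `5ε`-neighbourhood of the compact null set `∂L`,
whose volume tends to 0. -/
lemma l1SetTendsto_of_subsetThickening (hR : 0 < R) {E : ℕ → Set (Euc (n + 1))}
    {L : Set (Euc (n + 1))} (hE : ∀ j, ∃ N, IsNormalField R (E j) N)
    (hL : ∃ N, IsNormalField R L N) (hLc : IsCompact L)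
    {ε : ℕ → ℝ} (hε : ∀ j, 0 < ε j) (hεR : ∀ j, 4 * ε j ≤ R) (hε0 : Tendsto ε atTop (𝓝 0))
    (h1 : ∀ j, SubsetThickening (ε j) (E j) L) (h2 : ∀ j, SubsetThickening (ε j) L (E j)) :
    L1SetTendsto E L := by
  obtain ⟨M, hM⟩ := hL
  have hc : IsCompact (frontier L) :=
    hLc.of_isClosed_subset isClosed_frontier hLc.isClosed.frontier_subset
  have hv : volume (frontier L) = 0 := volume_eq_zero_of_hausdorffMeasure_lt_top
    (hM.hausdorffMeasure_frontier_lt_top hR hLc)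
  have ht := (tendsto_measure_cthickening_of_isCompact (μ := volume) hc).comp
    (show Tendsto (fun j => 5 * ε j) atTop (𝓝 0) by simpa using hε0.const_mul 5)
  rw [hv] at ht
  refine tendsto_of_tendsto_of_tendsto_of_le_of_le tendsto_const_nhds ht (fun _ => zero_le) fun j => ?_
  obtain ⟨N, hN⟩ := hE j
  have hsub : ∀ x, ¬ (x ∈ E j ↔ x ∈ L) → x ∈ Metric.cthickening (5 * ε j) (frontier L) := by
    intro x hx
    suffices h : ∃ q ∈ frontier L, dist x q ≤ 5 * ε j by
      obtain ⟨q, hq, hxq⟩ := h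
      exact Metric.mem_cthickening_of_dist_le x q _ _ hq hxq
    by_cases hxE : x ∈ E j
    · have hxL : x ∉ L := fun h => hx ⟨fun _ => h, fun _ => hxE⟩
      obtain ⟨b, hb, hxb⟩ := h1 j x hxE
      obtain ⟨c, hc, -, hxc⟩ := exists_frontier_dist_le hb hxL
      rw [dist_comm b] at hxc
      exact ⟨c, hc, by linarith [hε j]⟩
    · have hxL : x ∈ L := by
        by_contra h
        exact hx ⟨fun h' => absurd h' hxE, fun h' => absurd h' h⟩
      obtain ⟨b, hb, hxb⟩ := h2 j x hxL
      obtain ⟨c, hc, -, hxc⟩ := exists_frontier_dist_le hb hxE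
      -- Here the segment only yields a point of the boundary of `E j` within `ε`; moving it to `∂L`
      -- costs another `4ε`.
      obtain ⟨q, hq, hcq⟩ := hN.exists_frontier_dist_le hM (hε j) (hεR j) (h1 j) (h2 j) c hc
      rw [dist_comm b] at hxc
      exact ⟨q, hq, by linarith [dist_triangle x c q]⟩
  rw [eLpNorm_one_eq_lintegral_enorm, Function.comp_apply,
    ← lintegral_indicator_one Metric.isClosed_cthickening.measurableSet]
  refine lintegral_mono fun x => ?_
  by_cases hx : x ∈ E j ↔ x ∈ L
  · have : (E j).indicator (fun _ => (1 : ℝ)) x = L.indicator (fun _ => (1 : ℝ)) x := by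
      by_cases hxL : x ∈ L
      · rw [Set.indicator_of_mem hxL, Set.indicator_of_mem (hx.2 hxL)]
      · rw [Set.indicator_of_notMem hxL, Set.indicator_of_notMem (fun h => hxL (hx.1 h))]
    simp [this]
  · rw [Set.indicator_of_mem (hsub x hx)]
    by_cases hxE : x ∈ E j <;> by_cases hxL : x ∈ L <;> simp [hxE, hxL]

end Measure

/-! ### Compactness -/

section Compactness

open TopologicalSpace

/-- Blaschke selection: the non-empty compact subsets of a compact space form a compact space for
the Hausdorff distance. -/
lemma exists_subseq_hausdorff_tendsto {X : Type*} [MetricSpace X] [ProperSpace X]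
    {E : ℕ → Set X} (hE : ∀ j, IsClosed (E j)) (hne : ∀ j, (E j).Nonempty)
    (hb : Bornology.IsBounded (⋃ j, E j)) :
    ∃ (L : Set X) (s : ℕ → ℕ) (δ : ℕ → ℝ), IsCompact L ∧ L.Nonempty ∧ StrictMono s ∧
      Tendsto δ atTop (𝓝 0) ∧ (∀ j, 0 < δ j) ∧
      (∀ j, SubsetThickening (δ j) (E (s j)) L) ∧ ∀ j, SubsetThickening (δ j) L (E (s j)) := by
  set K : Set X := closure (⋃ j, E j)
  have hK : IsCompact K := hb.isCompact_closure
  have : CompactSpace K := isCompact_iff_compactSpace.1 hK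
  have hEK : ∀ j, E j ⊆ K := fun j => (Set.subset_iUnion E j).trans subset_closure
  have hEc : ∀ j, IsCompact (E j) := fun j => hK.of_isClosed_subset (hE j) (hEK j)
  let F : ℕ → NonemptyCompacts K := fun j =>
    { carrier := (Subtype.val : K → X) ⁻¹' E j
      isCompact' := ((hE j).preimage continuous_subtype_val).isCompact
      nonempty' := by
        obtain ⟨x, hx⟩ := hne j
        exact ⟨⟨x, hEK j hx⟩, hx⟩ }
  obtain ⟨G, s, hs, hG⟩ := CompactSpace.tendsto_subseq F
  have hd := tendsto_iff_dist_tendsto_zero.1 hG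
  -- The summand `1/(j+1)` makes the bound positive and strictly larger than the Hausdorff distance,
  -- as the selection of nearby points requires.
  refine ⟨Subtype.val '' (G : Set K), s, fun j => dist (F (s j)) G + 1 / ((j : ℝ) + 1),
    G.isCompact.image continuous_subtype_val, G.nonempty.image _, hs, ?_, ?_, ?_, ?_⟩
  · simpa using hd.add tendsto_one_div_add_atTop_nhds_zero_nat
  · intro j
    positivity
  · intro j a ha
    have hlt : Metric.hausdorffDist (F (s j) : Set K) G < dist (F (s j)) G + 1 / ((j : ℝ) + 1) := by
      rw [Metric.NonemptyCompacts.dist_eq]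
      have : 0 < 1 / ((j : ℝ) + 1) := by positivity
      linarith
    obtain ⟨y, hy, hay⟩ := Metric.exists_dist_lt_of_hausdorffDist_lt
      (x := (⟨a, hEK _ ha⟩ : K)) (show _ ∈ (F (s j) : Set K) from ha) hlt
      (edist_ne_top (F (s j)) G)
    exact ⟨y, ⟨y, hy, rfl⟩, hay.le⟩
  · rintro j _ ⟨y, hy, rfl⟩
    have hlt : Metric.hausdorffDist (F (s j) : Set K) G < dist (F (s j)) G + 1 / ((j : ℝ) + 1) := by
      rw [Metric.NonemptyCompacts.dist_eq]
      have : 0 < 1 / ((j : ℝ) + 1) := by positivity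
      linarith
    obtain ⟨x, hx, hxy⟩ := Metric.exists_dist_lt_of_hausdorffDist_lt' hy hlt
      (edist_ne_top (F (s j)) G)
    refine ⟨x, hx, ?_⟩
    rw [dist_comm]
    exact hxy.le

/-- A Hausdorff limit of sets with two-sided tangent balls has two-sided tangent balls. -/
lemma exists_isUnitNormal_of_tendsto {V : Type*} [NormedAddCommGroup V] [InnerProductSpace ℝ V]
    [ProperSpace V] {R : ℝ} {E : ℕ → Set V} {L : Set V} (hL : IsClosed L)
    (hE : ∀ j, ∃ N, IsNormalField R (E j) N)
    {δ : ℕ → ℝ} (hδ0 : Tendsto δ atTop (𝓝 0))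
    (h1 : ∀ j, SubsetThickening (δ j) (E j) L) (h2 : ∀ j, SubsetThickening (δ j) L (E j))
    {p : V} (hp : p ∈ frontier L) : ∃ ν, IsUnitNormal R L p ν := by
  have hlim : ∀ (x : V), (∃ᶠ j in atTop, x ∈ E j) → x ∈ L := by
    intro x hx
    rw [← hL.closure_eq, Metric.mem_closure_iff]
    intro ε hε
    obtain ⟨j, hj, hjε⟩ := (hx.and_eventually (hδ0.eventually_lt_const hε)).exists
    obtain ⟨b, hb, hxb⟩ := h1 j x hj
    exact ⟨b, hb, hxb.trans_lt hjε⟩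
  have hpL : p ∈ L := hL.frontier_subset hp
  -- Near `p` there is a point `b ∉ L`, eventually outside `E j`, while `E j` has points near `p`; a
  -- segment joining them crosses the boundary.
  have hnear : ∀ ε > 0, ∀ᶠ j in atTop, ∃ c ∈ frontier (E j), dist p c < ε := by
    intro ε hε
    have hpc : p ∈ closure Lᶜ := by
      have := frontier_compl L ▸ hp
      exact this.1
    obtain ⟨b, hb, hpb⟩ := Metric.mem_closure_iff.1 hpc (ε / 4) (by positivity)
    have hbE : ∀ᶠ j in atTop, b ∉ E j := by
      by_contra h
      exact hb (hlim b (by simpa [Filter.Frequently] using h))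
    filter_upwards [hbE, hδ0.eventually_lt_const (show 0 < ε / 4 by positivity)] with j hbj hj
    obtain ⟨a, ha, hpa⟩ := h2 j p hpL
    obtain ⟨c, hc, hac, -⟩ := exists_frontier_dist_le ha hbj
    refine ⟨c, hc, ?_⟩
    have := dist_triangle p a c
    have := dist_triangle_left a b p
    linarith
  have hsel : ∀ k : ℕ, ∃ j, k ≤ j ∧ ∃ c ∈ frontier (E j), dist p c < 1 / ((k : ℝ) + 1) := fun k =>
    ((eventually_ge_atTop k).and (hnear _ (by positivity))).exists
  choose m hm c hc hpc using hsel
  choose N hN using hE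
  have hcp : Tendsto c atTop (𝓝 p) := by
    rw [tendsto_iff_dist_tendsto_zero]
    refine squeeze_zero (fun _ => dist_nonneg) (fun k => ?_) tendsto_one_div_add_atTop_nhds_zero_nat
    rw [dist_comm]
    exact (hpc k).le
  have hNc : ∀ k, IsUnitNormal R (E (m k)) (c k) (N (m k) (c k)) := fun k => hN _ _ (hc k)
  obtain ⟨ν, -, s, hs, hν⟩ := tendsto_subseq_of_bounded (x := fun k => N (m k) (c k))
    (Metric.isBounded_closedBall (x := (0 : V)) (r := 1))
    (fun k => by rw [mem_closedBall_zero_iff, (hNc k).norm_eq])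
  have hcs := hcp.comp hs.tendsto_atTop
  have hms : Tendsto (fun k => m (s k)) atTop atTop :=
    tendsto_atTop_mono (fun k => hm (s k)) hs.tendsto_atTop
  refine ⟨ν, ?_, ?_, ?_⟩
  · refine tendsto_nhds_unique hν.norm ?_
    simp only [Function.comp_apply, (hNc _).norm_eq]
    exact tendsto_const_nhds
  · intro x hx
    have ht : Tendsto (fun k => dist x (c (s k) - R • N (m (s k)) (c (s k)))) atTop
        (𝓝 (dist x (p - R • ν))) := tendsto_const_nhds.dist (hcs.sub (hν.const_smul R))
    refine hlim x (hms.frequently (Eventually.frequently ?_))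
    filter_upwards [ht.eventually_lt_const hx] with k hk
    exact (hNc (s k)).inner_ball hk
  · intro x hx
    choose a ha hxa using fun k => h2 (m (s k)) x hx
    have hax : Tendsto a atTop (𝓝 x) := by
      rw [tendsto_iff_dist_tendsto_zero]
      refine squeeze_zero (fun _ => dist_nonneg) (fun k => ?_) (hδ0.comp hms)
      rw [dist_comm]
      exact hxa k
    refine ge_of_tendsto (hax.dist (hcs.add (hν.const_smul R))) (Eventually.of_forall fun k => ?_)
    exact (hNc (s k)).outer_ball _ (ha k)

end Compactness

/-! ### Adapted coordinates -/

section Coordinates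

variable {n : ℕ} (p : Euc (n + 1)) (b : OrthonormalBasis (Fin (n + 1)) ℝ (Euc (n + 1)))

lemma coordPoint_sub (x y : Euc n) (z w : ℝ) :
    coordPoint p b x z - coordPoint p b y w =
      (∑ i : Fin n, (x i - y i) • b i.castSucc) + (z - w) • b (Fin.last n) := by
  simp only [coordPoint, sub_smul, Finset.sum_sub_distrib]
  abel

lemma coordPoint_zero : coordPoint p b 0 0 = p := by
  simp [coordPoint]

lemma inner_coordPoint_sub (x y : Euc n) (z w : ℝ) (ν : Euc (n + 1)) :
    inner ℝ (coordPoint p b x z - coordPoint p b y w) ν =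
      (∑ i : Fin n, (x i - y i) * inner ℝ (b i.castSucc) ν)
        + (z - w) * inner ℝ (b (Fin.last n)) ν := by
  rw [coordPoint_sub, inner_add_left, sum_inner, real_inner_smul_left]
  simp only [real_inner_smul_left]

lemma inner_coordPoint_sub_last (x y : Euc n) (z w : ℝ) :
    inner ℝ (coordPoint p b x z - coordPoint p b y w) (b (Fin.last n)) = z - w := by
  rw [inner_coordPoint_sub]
  simp [b.inner_eq_ite]

lemma norm_coordPoint_sub_sq (x y : Euc n) (z w : ℝ) :
    ‖coordPoint p b x z - coordPoint p b y w‖ ^ 2 = ‖x - y‖ ^ 2 + (z - w) ^ 2 := by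
  rw [← b.sum_sq_norm_inner_left, Fin.sum_univ_castSucc, inner_coordPoint_sub_last,
    EuclideanSpace.norm_sq_eq]
  congr 1
  · refine Finset.sum_congr rfl fun i _ => ?_
    rw [inner_coordPoint_sub]
    simp [b.inner_eq_ite, (Fin.castSucc_ne_last i).symm]
  · rw [Real.norm_eq_abs, sq_abs]

lemma exists_eq_coordPoint (q : Euc (n + 1)) : ∃ x z, q = coordPoint p b x z := by
  refine ⟨WithLp.toLp 2 fun i => inner ℝ (b i.castSucc) (q - p), inner ℝ (b (Fin.last n)) (q - p), ?_⟩
  have h := b.sum_repr' (q - p)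
  rw [Fin.sum_univ_castSucc] at h
  simp only [coordPoint, add_assoc, h, add_sub_cancel]

lemma norm_sub_le_of_coordPoint (x y : Euc n) (z w : ℝ) :
    ‖x - y‖ ≤ ‖coordPoint p b x z - coordPoint p b y w‖ := by
  refine (abs_le_of_sq_le_sq' ?_ (norm_nonneg _)).2
  rw [norm_coordPoint_sub_sq]
  nlinarith [sq_nonneg (z - w)]

lemma norm_coordPoint_sub_origin_sq (x : Euc n) (z : ℝ) :
    ‖coordPoint p b x z - p‖ ^ 2 = ‖x‖ ^ 2 + z ^ 2 := by
  have := norm_coordPoint_sub_sq p b x 0 z 0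
  rwa [coordPoint_zero, sub_zero, sub_zero] at this

lemma norm_coordPoint_sub_origin_le {R : ℝ} (hR : 0 < R) {x : Euc n} {z : ℝ}
    (hx : ‖x‖ ≤ 1 / 10 * R) (hz : |z| ≤ 1 / 10 * R) : ‖coordPoint p b x z - p‖ ≤ 3 / 20 * R := by
  refine (abs_le_of_sq_le_sq' ?_ (by positivity)).2
  rw [norm_coordPoint_sub_origin_sq]
  have h1 : ‖x‖ ^ 2 ≤ (1 / 10 * R) ^ 2 := by gcongr
  have h2 : z ^ 2 ≤ (1 / 10 * R) ^ 2 := by rw [← sq_abs]; gcongr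
  nlinarith

end Coordinates

/-! ### Boundaries as graphs -/

/-- The boundary of `A` passes close to `p`, with a normal close to the last vector of `b`. -/
structure IsAlmostAdapted {n : ℕ} (R : ℝ) (A : Set (Euc (n + 1)))
    (N : Euc (n + 1) → Euc (n + 1)) (p : Euc (n + 1))
    (b : OrthonormalBasis (Fin (n + 1)) ℝ (Euc (n + 1))) : Prop where
  normal : IsNormalField R A N
  exists_near : ∃ q ∈ frontier A, ‖q - p‖ ≤ R / 50 ∧ ‖N q - b (Fin.last n)‖ ≤ 1 / 20

/-- `f` parametrizes a part of the boundary of `A` over the ball of radius `R / 10`. -/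
def IsBoundaryGraph {n : ℕ} (R : ℝ) (A : Set (Euc (n + 1))) (p : Euc (n + 1))
    (b : OrthonormalBasis (Fin (n + 1)) ℝ (Euc (n + 1))) (f : Euc n → ℝ) : Prop :=
  ∀ x, ‖x‖ ≤ 1 / 10 * R → |f x| ≤ 1 / 10 * R ∧ coordPoint p b x (f x) ∈ frontier A

/-- The gradient of the function parametrizing a hypersurface with normal field `N`. -/
noncomputable def graphGradient {n : ℕ} (N : Euc (n + 1) → Euc (n + 1)) (p : Euc (n + 1))
    (b : OrthonormalBasis (Fin (n + 1)) ℝ (Euc (n + 1))) (f : Euc n → ℝ) (i : Fin n)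
    (x : Euc n) : ℝ :=
  -inner ℝ (b i.castSucc) (N (coordPoint p b x (f x))) /
    inner ℝ (b (Fin.last n)) (N (coordPoint p b x (f x)))

section Graph

variable {n : ℕ} {R : ℝ} {A : Set (Euc (n + 1))} {N : Euc (n + 1) → Euc (n + 1)}
  {p : Euc (n + 1)} {b : OrthonormalBasis (Fin (n + 1)) ℝ (Euc (n + 1))}

namespace IsAlmostAdapted

lemma norm_normal_sub_le (h : IsAlmostAdapted R A N p b) (hR : 0 < R) {q : Euc (n + 1)}
    (hq : q ∈ frontier A) (hqp : ‖q - p‖ ≤ R / 5) : ‖N q - b (Fin.last n)‖ ≤ 3 / 10 := by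
  obtain ⟨q₀, hq₀, h1, h2⟩ := h.exists_near
  have h3 := (h.normal q hq).mul_norm_sub_le hR (h.normal q₀ hq₀)
  have h4 : ‖q - q₀‖ ≤ R / 5 + R / 50 := by
    rw [show q - q₀ = (q - p) - (q₀ - p) by abel]
    exact (norm_sub_le _ _).trans (by linarith)
  have h5 : ‖N q - N q₀‖ ≤ 1 / 5 + 1 / 50 := by
    have : R * ‖N q - N q₀‖ ≤ R * (1 / 5 + 1 / 50) := by linarith
    exact le_of_mul_le_mul_left this hR
  rw [show N q - b (Fin.last n) = (N q - N q₀) + (N q₀ - b (Fin.last n)) by abel]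
  exact (norm_add_le _ _).trans (by linarith)

lemma half_le_inner (h : IsAlmostAdapted R A N p b) (hR : 0 < R) {q : Euc (n + 1)}
    (hq : q ∈ frontier A) (hqp : ‖q - p‖ ≤ R / 5) :
    1 / 2 ≤ inner ℝ (b (Fin.last n)) (N q) := by
  have h1 := h.norm_normal_sub_le hR hq hqp
  have h2 := norm_sub_sq_real (N q) (b (Fin.last n))
  rw [(h.normal q hq).norm_eq, b.norm_eq_one, real_inner_comm] at h2
  have : ‖N q - b (Fin.last n)‖ ^ 2 ≤ (3 / 10) ^ 2 := by gcongr
  linarith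

/-- The boundary is contained in a cone around each of its points. -/
lemma abs_sub_le (h : IsAlmostAdapted R A N p b) (hR : 0 < R) {x y : Euc n} {z w : ℝ}
    (hx : coordPoint p b x z ∈ frontier A) (hy : coordPoint p b y w ∈ frontier A)
    (hxp : ‖coordPoint p b x z - p‖ ≤ R / 5) (hyp : ‖coordPoint p b y w - p‖ ≤ R / 5) :
    |z - w| ≤ ‖x - y‖ := by
  have h1 := (h.normal _ hy).two_mul_abs_inner_le hR hx
  have h2 := h.norm_normal_sub_le hR hy hyp
  have h3 := norm_coordPoint_sub_sq p b x y z w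
  have h4 := inner_coordPoint_sub_last p b x y z w
  set q := coordPoint p b x z
  set q' := coordPoint p b y w
  have h5 : ‖q - q'‖ ≤ 2 * R / 5 := by
    rw [show q - q' = (q - p) - (q' - p) by abel]
    exact (norm_sub_le _ _).trans (by linarith)
  have h6 : |inner ℝ (q - q') (N q')| ≤ 1 / 5 * ‖q - q'‖ := by
    have : 2 * R * |inner ℝ (q - q') (N q')| ≤ 2 * R * (1 / 5 * ‖q - q'‖) := by
      nlinarith [norm_nonneg (q - q')]
    exact le_of_mul_le_mul_left this (by positivity)
  have h7 : |z - w| ≤ 1 / 5 * ‖q - q'‖ + ‖q - q'‖ * (3 / 10) := by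
    have e : inner ℝ (q - q') (b (Fin.last n)) =
        inner ℝ (q - q') (N q') - inner ℝ (q - q') (N q' - b (Fin.last n)) := by
      rw [← inner_sub_right]; congr 1; abel
    rw [← h4, e]
    refine (abs_sub _ _).trans (add_le_add h6 ?_)
    exact (abs_real_inner_le_norm _ _).trans (by gcongr)
  refine (abs_le_of_sq_le_sq' ?_ (norm_nonneg _)).2
  -- The vertical part is at most half the chord, so by Pythagoras `(z - w)²` is at most a third of
  -- `‖x - y‖²`.
  have h8 : |z - w| ^ 2 ≤ (1 / 2 * ‖q - q'‖) ^ 2 := by gcongr; linarith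
  rw [mul_pow, h3, sq_abs] at h8
  rw [sq_abs]
  nlinarith [sq_nonneg ‖x - y‖]

/-- The vertical segment over `x` runs from the interior ball touching at the nearby point `q` to
the exterior one, so it crosses the boundary. The distance to either centre is at most `(0.92 + 0.02
+ 0.05)R < R`. -/
lemma exists_height (h : IsAlmostAdapted R A N p b) (hR : 0 < R) {x : Euc n}
    (hx : ‖x‖ ≤ 1 / 10 * R) :
    ∃ z, |z| ≤ 1 / 10 * R ∧ coordPoint p b x z ∈ frontier A := by
  obtain ⟨q, hq, h1, h2⟩ := h.exists_near
  have hN := h.normal q hq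
  have hx2 : ‖x‖ ^ 2 ≤ (1 / 10 * R) ^ 2 := by gcongr
  have key : ∀ s : ℝ, |s| = 1 →
      dist (coordPoint p b x (s * (1 / 10 * R))) (q + (s * R) • N q) < R := by
    intro s hs
    have hs2 : s ^ 2 = 1 := by rw [← sq_abs, hs]; norm_num
    have e0 : coordPoint p b 0 (s * R) = p + (s * R) • b (Fin.last n) := by simp [coordPoint]
    have e : coordPoint p b x (s * (1 / 10 * R)) - (q + (s * R) • N q) =
        (coordPoint p b x (s * (1 / 10 * R)) - coordPoint p b 0 (s * R)) - (q - p)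
          - (s * R) • (N q - b (Fin.last n)) := by
      rw [e0]; module
    have h3 : ‖coordPoint p b x (s * (1 / 10 * R)) - coordPoint p b 0 (s * R)‖ ≤ 92 / 100 * R := by
      refine (abs_le_of_sq_le_sq' ?_ (by positivity)).2
      rw [norm_coordPoint_sub_sq, sub_zero]
      have : (s * (1 / 10 * R) - s * R) ^ 2 = s ^ 2 * (9 / 10 * R) ^ 2 := by ring
      rw [this, hs2]
      nlinarith
    have h4 : ‖(s * R) • (N q - b (Fin.last n))‖ ≤ R * (1 / 20) := by
      rw [norm_smul, Real.norm_eq_abs, abs_mul, hs, one_mul, abs_of_pos hR]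
      gcongr
    rw [dist_eq_norm, e]
    have := norm_sub_le ((coordPoint p b x (s * (1 / 10 * R)) - coordPoint p b 0 (s * R)) - (q - p))
      ((s * R) • (N q - b (Fin.last n)))
    have := norm_sub_le (coordPoint p b x (s * (1 / 10 * R)) - coordPoint p b 0 (s * R)) (q - p)
    linarith
  have hin : coordPoint p b x (-1 * (1 / 10 * R)) ∈ A := by
    refine hN.inner_ball ?_
    have := key (-1) (by norm_num)
    rwa [neg_one_mul R, neg_smul, ← sub_eq_add_neg] at this
  have hout : coordPoint p b x (1 * (1 / 10 * R)) ∉ A := by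
    intro hmem
    have := key 1 (by norm_num)
    rw [one_mul R] at this
    exact absurd (hN.outer_ball _ hmem) (not_le.2 this)
  obtain ⟨c, hc, hcA⟩ := exists_mem_segment_frontier hin hout
  rw [segment_eq_image'] at hc
  obtain ⟨θ, ⟨h0, h1'⟩, rfl⟩ := hc
  refine ⟨(2 * θ - 1) * (1 / 10 * R), ?_, ?_⟩
  · rw [abs_mul, abs_of_pos (show 0 < 1 / 10 * R by positivity)]
    have : |2 * θ - 1| ≤ 1 := abs_le.2 ⟨by linarith, by linarith⟩
    nlinarith
  · convert hcA using 1
    simp only [coordPoint]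
    module

lemma exists_isBoundaryGraph (h : IsAlmostAdapted R A N p b) (hR : 0 < R) :
    ∃ f, IsBoundaryGraph R A p b f := by
  have : ∀ x : Euc n, ∃ z, ‖x‖ ≤ 1 / 10 * R →
      |z| ≤ 1 / 10 * R ∧ coordPoint p b x z ∈ frontier A := by
    intro x
    by_cases hx : ‖x‖ ≤ 1 / 10 * R
    · obtain ⟨z, hz⟩ := h.exists_height hR hx
      exact ⟨z, fun _ => hz⟩
    · exact ⟨0, fun h' => absurd h' hx⟩
  choose f hf using this
  exact ⟨f, hf⟩

end IsAlmostAdapted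

namespace IsBoundaryGraph

variable {f : Euc n → ℝ}

lemma norm_sub_le (hf : IsBoundaryGraph R A p b f) (hR : 0 < R) {x : Euc n}
    (hx : ‖x‖ ≤ 1 / 10 * R) : ‖coordPoint p b x (f x) - p‖ ≤ R / 5 :=
  (norm_coordPoint_sub_origin_le p b hR hx (hf x hx).1).trans (by linarith)

/-- The cone condition `IsAlmostAdapted.abs_sub_le` over a single base point leaves only one height.
-/
lemma frontier_inter_coordCylinder (hf : IsBoundaryGraph R A p b f)
    (h : IsAlmostAdapted R A N p b) (hR : 0 < R) :
    frontier A ∩ coordCylinder p b (1 / 10 * R) = coordGraph p b (1 / 10 * R) f := by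
  ext q
  constructor
  · rintro ⟨hq, x, hx, z, hz, rfl⟩
    rw [mem_closedBall_zero_iff] at hx
    have := h.abs_sub_le hR hq (hf x hx).2
      ((norm_coordPoint_sub_origin_le p b hR hx (abs_le.2 hz)).trans (by linarith))
      (hf.norm_sub_le hR hx)
    rw [sub_self, norm_zero] at this
    have hzf : z = f x := sub_eq_zero.1 (abs_nonpos_iff.1 this)
    exact ⟨x, by rwa [mem_closedBall_zero_iff], by rw [hzf]⟩
  · rintro ⟨x, hx, rfl⟩
    have hx' := mem_closedBall_zero_iff.1 hx
    exact ⟨(hf x hx').2, x, hx, f x, abs_le.1 (hf x hx').1, rfl⟩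

lemma half_le_inner (hf : IsBoundaryGraph R A p b f) (h : IsAlmostAdapted R A N p b) (hR : 0 < R)
    {x : Euc n} (hx : ‖x‖ ≤ 1 / 10 * R) : 1 / 2 ≤ inner ℝ (b (Fin.last n)) (N (coordPoint p b x (f x))) :=
  h.half_le_inner hR (hf x hx).2 (hf.norm_sub_le hR hx)

lemma abs_inner_le (hf : IsBoundaryGraph R A p b f) (h : IsAlmostAdapted R A N p b)
    {x : Euc n} (hx : ‖x‖ ≤ 1 / 10 * R) (i : Fin (n + 1)) : |inner ℝ (b i) (N (coordPoint p b x (f x)))| ≤ 1 := by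
  refine (abs_real_inner_le_norm _ _).trans ?_
  rw [b.norm_eq_one, (h.normal _ (hf x hx).2).norm_eq, mul_one]

lemma abs_graphGradient_le (hf : IsBoundaryGraph R A p b f) (h : IsAlmostAdapted R A N p b) (hR : 0 < R)
    {x : Euc n} (hx : ‖x‖ ≤ 1 / 10 * R) (i : Fin n) : |graphGradient N p b f i x| ≤ 2 := by
  have h1 := hf.half_le_inner h hR hx
  have h2 := hf.abs_inner_le h hx i.castSucc
  rw [graphGradient, abs_div, abs_neg, abs_of_pos (lt_of_lt_of_le one_half_pos h1),
    div_le_iff₀ (by linarith)]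
  linarith

lemma abs_sub_le (hf : IsBoundaryGraph R A p b f) (h : IsAlmostAdapted R A N p b) (hR : 0 < R)
    {x y : Euc n} (hx : ‖x‖ ≤ 1 / 10 * R) (hy : ‖y‖ ≤ 1 / 10 * R) : |f x - f y| ≤ ‖x - y‖ :=
  h.abs_sub_le hR (hf x hx).2 (hf y hy).2 (hf.norm_sub_le hR hx) (hf.norm_sub_le hR hy)

lemma norm_coordPoint_sub_le (hf : IsBoundaryGraph R A p b f) (h : IsAlmostAdapted R A N p b) (hR : 0 < R)
    {x y : Euc n} (hx : ‖x‖ ≤ 1 / 10 * R) (hy : ‖y‖ ≤ 1 / 10 * R) :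
    ‖coordPoint p b x (f x) - coordPoint p b y (f y)‖ ^ 2 ≤ 2 * ‖x - y‖ ^ 2 := by
  rw [norm_coordPoint_sub_sq, ← sq_abs (f x - f y)]
  have := hf.abs_sub_le h hR hx hy
  have : |f x - f y| ^ 2 ≤ ‖x - y‖ ^ 2 := by gcongr
  linarith

/-- Numerator and denominator vary by at most `D = (2/R)‖x - y‖`, and the denominator is at least
`1/2`; the quotient varies by at most `2D + 4D`. -/
lemma abs_graphGradient_sub_le (hf : IsBoundaryGraph R A p b f) (h : IsAlmostAdapted R A N p b) (hR : 0 < R)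
    {x y : Euc n} (hx : ‖x‖ ≤ 1 / 10 * R) (hy : ‖y‖ ≤ 1 / 10 * R) (i : Fin n) :
    |graphGradient N p b f i x - graphGradient N p b f i y| ≤ 12 / R * ‖x - y‖ := by
  have hN := (h.normal _ (hf x hx).2).mul_norm_sub_le hR (h.normal _ (hf y hy).2)
  have hq : ‖coordPoint p b x (f x) - coordPoint p b y (f y)‖ ≤ 2 * ‖x - y‖ := by
    refine (abs_le_of_sq_le_sq' ?_ (by positivity)).2
    nlinarith [hf.norm_coordPoint_sub_le h hR hx hy, sq_nonneg ‖x - y‖]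
  have hd : ‖N (coordPoint p b x (f x)) - N (coordPoint p b y (f y))‖ ≤ 2 / R * ‖x - y‖ := by
    rw [div_mul_eq_mul_div, le_div_iff₀ hR]
    linarith
  have hcx := hf.half_le_inner h hR hx
  have hcy := hf.half_le_inner h hR hy
  have hay := hf.abs_inner_le h hy i.castSucc
  have hsub : ∀ k, |inner ℝ (b k) (N (coordPoint p b x (f x)))
      - inner ℝ (b k) (N (coordPoint p b y (f y)))| ≤ 2 / R * ‖x - y‖ := fun k => by
    rw [← inner_sub_right]
    refine (abs_real_inner_le_norm _ _).trans ?_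
    rwa [b.norm_eq_one, one_mul]
  have h1 := hsub i.castSucc
  have h2 := hsub (Fin.last n)
  simp only [graphGradient]
  set a := inner ℝ (b i.castSucc) (N (coordPoint p b x (f x)))
  set a' := inner ℝ (b i.castSucc) (N (coordPoint p b y (f y)))
  set c := inner ℝ (b (Fin.last n)) (N (coordPoint p b x (f x)))
  set c' := inner ℝ (b (Fin.last n)) (N (coordPoint p b y (f y)))
  have e : -a / c - -a' / c' = -((a - a') / c) + (a' / c') * ((c - c') / c) := by
    have : c ≠ 0 := by linarith
    have : c' ≠ 0 := by linarith
    field_simp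
    ring
  set D := 2 / R * ‖x - y‖ with hD
  have hD0 : 0 ≤ D := (abs_nonneg _).trans h1
  have h3 : |(a - a') / c| ≤ 2 * D := by
    rw [abs_div, abs_of_pos (show 0 < c by linarith), div_le_iff₀ (by linarith)]
    nlinarith
  have h4 : |(c - c') / c| ≤ 2 * D := by
    rw [abs_div, abs_of_pos (show 0 < c by linarith), div_le_iff₀ (by linarith)]
    nlinarith
  have h5 : |a' / c'| ≤ 2 := by
    rw [abs_div, abs_of_pos (show 0 < c' by linarith), div_le_iff₀ (by linarith)]
    linarith
  rw [e]
  refine (abs_add_le _ _).trans ?_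
  rw [abs_neg, abs_mul]
  have h6 : |a' / c'| * |(c - c') / c| ≤ 2 * (2 * D) := by gcongr
  have h7 : 12 / R * ‖x - y‖ = 6 * D := by rw [hD]; ring
  linarith

/-- This is the quadratic tangent-plane estimate divided by the last component of the normal. It
identifies `graphGradient` as the classical gradient. -/
lemma abs_sub_sub_sum_graphGradient_le (hf : IsBoundaryGraph R A p b f) (h : IsAlmostAdapted R A N p b) (hR : 0 < R)
    {x y : Euc n} (hx : ‖x‖ ≤ 1 / 10 * R) (hy : ‖y‖ ≤ 1 / 10 * R) :
    |f y - f x - ∑ i, graphGradient N p b f i x * (y i - x i)| ≤ 2 / R * ‖y - x‖ ^ 2 := by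
  have h1 := (h.normal _ (hf x hx).2).two_mul_abs_inner_le hR (hf y hy).2
  have h2 := hf.norm_coordPoint_sub_le h hR hy hx
  have hc := hf.half_le_inner h hR hx
  rw [inner_coordPoint_sub] at h1
  simp only [graphGradient]
  set c := inner ℝ (b (Fin.last n)) (N (coordPoint p b x (f x)))
  set S := ∑ i, (y i - x i) * inner ℝ (b i.castSucc) (N (coordPoint p b x (f x)))
  have hc0 : c ≠ 0 := by linarith
  have e : f y - f x - ∑ i, -inner ℝ (b i.castSucc) (N (coordPoint p b x (f x))) / c * (y i - x i)
      = (S + (f y - f x) * c) / c := by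
    have : ∑ i, -inner ℝ (b i.castSucc) (N (coordPoint p b x (f x))) / c * (y i - x i) = -S / c := by
      rw [neg_div, Finset.sum_div, ← Finset.sum_neg_distrib]
      exact Finset.sum_congr rfl fun i _ => by ring
    rw [this]
    field_simp
    ring
  rw [e, abs_div, abs_of_pos (show 0 < c by linarith), div_le_iff₀ (by linarith)]
  have h3 : |S + (f y - f x) * c| ≤ 1 / R * ‖y - x‖ ^ 2 := by
    rw [div_mul_eq_mul_div, le_div_iff₀ hR]
    linarith
  have h4 : 0 ≤ 2 / R * ‖y - x‖ ^ 2 := by positivity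
  have h5 : 1 / R * ‖y - x‖ ^ 2 = 2 / R * ‖y - x‖ ^ 2 * (1 / 2) := by ring
  have h6 : 2 / R * ‖y - x‖ ^ 2 * (1 / 2) ≤ 2 / R * ‖y - x‖ ^ 2 * c := by gcongr
  linarith

end IsBoundaryGraph

end Graph

/-! ### The radial retraction onto a ball -/

section RadialRetraction

variable {V : Type*} [NormedAddCommGroup V] [NormedSpace ℝ V]

/-- The radial retraction onto the closed ball of radius `r` around the origin. -/
noncomputable def radialRetraction (r : ℝ) (x : V) : V :=
  (r / max r ‖x‖) • x

variable {r : ℝ}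

lemma radialRetraction_of_norm_le (hr : 0 < r) {x : V} (hx : ‖x‖ ≤ r) :
    radialRetraction r x = x := by
  rw [radialRetraction, max_eq_left hx, div_self hr.ne', one_smul]

lemma norm_radialRetraction_le (hr : 0 < r) (x : V) : ‖radialRetraction r x‖ ≤ r := by
  have hm : 0 < max r ‖x‖ := lt_max_of_lt_left hr
  rw [radialRetraction, norm_smul, Real.norm_of_nonneg (by positivity), div_mul_eq_mul_div,
    div_le_iff₀ hm]
  exact mul_le_mul_of_nonneg_left (le_max_right _ _) hr.le

lemma norm_radialRetraction_sub_le (hr : 0 < r) (x y : V) :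
    ‖radialRetraction r x - radialRetraction r y‖ ≤ 2 * ‖x - y‖ := by
  have hx : 0 < max r ‖x‖ := lt_max_of_lt_left hr
  have hy : 0 < max r ‖y‖ := lt_max_of_lt_left hr
  have e : radialRetraction r x - radialRetraction r y =
      (r / max r ‖x‖) • (x - y) + (r / max r ‖x‖ - r / max r ‖y‖) • y := by
    simp only [radialRetraction]; module
  have h1 : r / max r ‖x‖ ≤ 1 := (div_le_one hx).2 (le_max_left _ _)
  have h2 : r / max r ‖x‖ - r / max r ‖y‖ =
      (r / max r ‖x‖) * ((max r ‖y‖ - max r ‖x‖) / max r ‖y‖) := by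
    field_simp
  have h3 : |max r ‖y‖ - max r ‖x‖| ≤ ‖x - y‖ := by
    have := abs_max_sub_max_le_abs ‖y‖ ‖x‖ r
    rw [max_comm r, max_comm r]
    exact this.trans ((abs_norm_sub_norm_le y x).trans (norm_sub_rev y x).le)
  have h4 : ‖y‖ / max r ‖y‖ ≤ 1 := (div_le_one hy).2 (le_max_right _ _)
  rw [e, h2]
  refine (norm_add_le _ _).trans ?_
  rw [norm_smul, norm_smul, Real.norm_of_nonneg (show 0 ≤ r / max r ‖x‖ by positivity),
    Real.norm_eq_abs, abs_mul, abs_div (_ - _), abs_of_pos hy,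
    abs_of_nonneg (show 0 ≤ r / max r ‖x‖ by positivity)]
  have h5 : r / max r ‖x‖ * (|max r ‖y‖ - max r ‖x‖| / max r ‖y‖) * ‖y‖ =
      r / max r ‖x‖ * (|max r ‖y‖ - max r ‖x‖| * (‖y‖ / max r ‖y‖)) := by ring
  rw [h5]
  have h6 : r / max r ‖x‖ * ‖x - y‖ ≤ 1 * ‖x - y‖ := by gcongr
  have h7 : r / max r ‖x‖ * (|max r ‖y‖ - max r ‖x‖| * (‖y‖ / max r ‖y‖)) ≤
      1 * (‖x - y‖ * 1) := by gcongr
  linarith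

/-- Heights and gradients are controlled only on a closed ball. Composing with the retraction makes
them globally Lipschitz without changing them there, so that integration by parts on the whole space
applies. -/
lemma lipschitzWith_comp_radialRetraction (hr : 0 < r) {u : V → ℝ} {K : ℝ} (hK : 0 ≤ K)
    (hu : ∀ x y, ‖x‖ ≤ r → ‖y‖ ≤ r → |u x - u y| ≤ K * ‖x - y‖) :
    LipschitzWith (2 * K).toNNReal fun x => u (radialRetraction r x) := by
  refine LipschitzWith.of_dist_le_mul fun x y => ?_
  rw [Real.coe_toNNReal _ (by positivity), Real.dist_eq, dist_eq_norm]
  refine (hu _ _ (norm_radialRetraction_le hr x) (norm_radialRetraction_le hr y)).trans ?_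
  have := mul_le_mul_of_nonneg_left (norm_radialRetraction_sub_le hr x y) hK
  linarith

end RadialRetraction

/-! ### Weak derivatives of Lipschitz functions -/

section WeakDerivatives

variable {n : ℕ}

lemma LipschitzWith.isWeakPartial {u g : Euc n → ℝ} {K : ℝ≥0} (hu : LipschitzWith K u)
    {Ω : Set (Euc n)} (hΩ : MeasurableSet Ω) {i : Fin n}
    (hg : ∀ x ∈ Ω, lineDeriv ℝ u x (EuclideanSpace.single i 1) = g x) :
    IsWeakPartial Ω i u g := by
  intro φ hφ hφc hφΩ
  have hφd : Differentiable ℝ φ := hφ.differentiable (by simp)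
  obtain ⟨D, hD⟩ : ∃ D, LipschitzWith D φ :=
    hφ.lipschitzWith_of_hasCompactSupport hφc (by simp)
  have h := LipschitzWith.integral_lineDeriv_mul_eq (μ := volume) hu hD hφc (EuclideanSpace.single i 1)
  have h1 : ∫ x in Ω, u x * fderiv ℝ φ x (EuclideanSpace.single i 1) =
      ∫ x, u x * fderiv ℝ φ x (EuclideanSpace.single i 1) := by
    refine setIntegral_eq_integral_of_forall_compl_eq_zero fun x hx => ?_
    have : fderiv ℝ φ x = 0 := by
      by_contra h0
      exact hx (hφΩ (support_fderiv_subset ℝ h0))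
    simp [this]
  have h2 : ∫ x in Ω, g x * φ x =
      ∫ x, lineDeriv ℝ u x (EuclideanSpace.single i 1) * φ x := by
    rw [setIntegral_congr_fun hΩ
      (g := fun x => lineDeriv ℝ u x (EuclideanSpace.single i 1) * φ x)
      (fun x hx => by simp only [hg x hx])]
    refine setIntegral_eq_integral_of_forall_compl_eq_zero fun x hx => ?_
    have : φ x = 0 := by
      by_contra h0
      exact hx (hφΩ (subset_tsupport φ h0))
    simp [this]
  rw [h1, h2, h, ← integral_neg]
  refine integral_congr_ae (Eventually.of_forall fun x => ?_)
  simp only [(hφd x).lineDeriv_eq_fderiv, map_neg]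
  ring

lemma tendsto_integral_mul_of_bounded {Ω : Set (Euc n)} {u : ℕ → Euc n → ℝ} {v : Euc n → ℝ}
    {M : ℝ} (hu : ∀ j, Continuous (u j)) (hM : ∀ j x, |u j x| ≤ M)
    (hlim : ∀ x, Tendsto (fun j => u j x) atTop (𝓝 (v x))) : WeakStarLInfty Ω u v := by
  intro φ hφ
  refine tendsto_integral_of_dominated_convergence (fun x => M * ‖φ x‖)
    (fun j => (hu j).aestronglyMeasurable.mul hφ.aestronglyMeasurable) (hφ.norm.const_mul M)
    (fun j => Eventually.of_forall fun x => ?_)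
    (Eventually.of_forall fun x => (hlim x).mul_const _)
  rw [norm_mul]
  gcongr
  exact hM j x

lemma integrable_lineDeriv_mul {u φ : Euc n → ℝ} {K : ℝ≥0} (hu : LipschitzWith K u) (e : Euc n)
    (hφ : Integrable φ) : Integrable fun x => lineDeriv ℝ u x e * φ x :=
  hφ.bdd_mul (measurable_lineDeriv hu.continuous).aestronglyMeasurable
    (Eventually.of_forall fun _ => norm_lineDeriv_le_of_lipschitz ℝ hu)

lemma abs_integral_lineDeriv_mul_le {u φ : Euc n → ℝ} {K : ℝ≥0} (hu : LipschitzWith K u)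
    (e : Euc n) (hφ : Integrable φ) :
    |∫ x, lineDeriv ℝ u x e * φ x| ≤ K * ‖e‖ * ∫ x, ‖φ x‖ := by
  have hb : ∀ x, ‖lineDeriv ℝ u x e * φ x‖ ≤ K * ‖e‖ * ‖φ x‖ := fun x => by
    rw [norm_mul]
    gcongr
    exact norm_lineDeriv_le_of_lipschitz ℝ hu
  rw [← integral_const_mul, ← Real.norm_eq_abs]
  exact norm_integral_le_of_norm_le (hφ.norm.const_mul _) (Eventually.of_forall hb)

/-- Directional derivatives of uniformly Lipschitz functions converge weakly* when the functions
converge pointwise. -/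
lemma weakStarLInfty_lineDeriv {Ω : Set (Euc n)} (hΩ : MeasurableSet Ω) {u : ℕ → Euc n → ℝ}
    {v : Euc n → ℝ} {K : ℝ≥0} {M : ℝ} (hu : ∀ j, LipschitzWith K (u j)) (hv : LipschitzWith K v)
    (hM : ∀ j x, |u j x| ≤ M) (hlim : ∀ x, Tendsto (fun j => u j x) atTop (𝓝 (v x)))
    (e : Euc n) :
    WeakStarLInfty Ω (fun j x => lineDeriv ℝ (u j) x e) fun x => lineDeriv ℝ v x e := by
  intro φ hφ
  have hΦ : Integrable (Ω.indicator φ) := (integrable_indicator_iff hΩ).2 hφ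
  have hset : ∀ w : Euc n → ℝ, ∫ x in Ω, w x * φ x = ∫ x, w x * Ω.indicator φ x := fun w => by
    rw [← integral_indicator hΩ]
    refine integral_congr_ae (Eventually.of_forall fun x => ?_)
    by_cases hx : x ∈ Ω <;> simp [hx]
  simp only [hset]
  set Φ := Ω.indicator φ
  -- Against a test function the derivative moves onto `ψ`, and dominated convergence applies. The
  -- uniform Lipschitz bound then extends the limit to all of L¹ by density.
  have hsmooth : ∀ ψ : Euc n → ℝ, HasCompactSupport ψ → ContDiff ℝ ∞ ψ →
      Tendsto (fun j => ∫ x, lineDeriv ℝ (u j) x e * ψ x) atTop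
        (𝓝 (∫ x, lineDeriv ℝ v x e * ψ x)) := by
    intro ψ hψc hψ
    obtain ⟨D, hD⟩ : ∃ D, LipschitzWith D ψ :=
      hψ.lipschitzWith_of_hasCompactSupport hψc (by simp)
    simp only [fun j => LipschitzWith.integral_lineDeriv_mul_eq (μ := volume) (hu j) hD hψc e,
      LipschitzWith.integral_lineDeriv_mul_eq (μ := volume) hv hD hψc e]
    have hint : Integrable fun x => lineDeriv ℝ ψ x (-e) := by
      have hψd : Differentiable ℝ ψ := hψ.differentiable (by simp)
      simp only [fun x => (hψd x).lineDeriv_eq_fderiv (v := -e)]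
      refine Continuous.integrable_of_hasCompactSupport ?_ ?_
      · exact (hψ.continuous_fderiv (by simp)).clm_apply continuous_const
      · exact hψc.fderiv_apply ℝ (-e)
    have := tendsto_integral_mul_of_bounded (Ω := Set.univ) (fun j => (hu j).continuous) hM hlim
      _ hint.integrableOn
    simpa only [setIntegral_univ, mul_comm] using this
  rw [Metric.tendsto_atTop]
  intro ε hε
  set C : ℝ := K * ‖e‖
  have hC : 0 ≤ C := by positivity
  obtain ⟨ψ, hψc, hψ, hψε⟩ := (memLp_one_iff_integrable.2 hΦ).exist_eLpNorm_sub_le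
    -- `C + 1` replaces `C`, which may vanish.
    ENNReal.one_ne_top le_rfl (show 0 < ε / (4 * (C + 1)) by positivity)
  have hψi : Integrable ψ := hψ.continuous.integrable_of_hasCompactSupport hψc
  have hdiff : ∫ x, ‖(Φ - ψ) x‖ ≤ ε / (4 * (C + 1)) := by
    rw [integral_norm_eq_lintegral_enorm (hΦ.sub hψi).aestronglyMeasurable,
      ← eLpNorm_one_eq_lintegral_enorm]
    exact ENNReal.toReal_le_of_le_ofReal (by positivity) hψε
  have hsplit : ∀ w : Euc n → ℝ, LipschitzWith K w →
      |(∫ x, lineDeriv ℝ w x e * Φ x) - ∫ x, lineDeriv ℝ w x e * ψ x| ≤ ε / 4 := by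
    intro w hw
    rw [← integral_sub (integrable_lineDeriv_mul hw e hΦ) (integrable_lineDeriv_mul hw e hψi)]
    have h1 := abs_integral_lineDeriv_mul_le hw e (hΦ.sub hψi)
    have h2 : C * (∫ x, ‖(Φ - ψ) x‖) ≤ (C + 1) * (ε / (4 * (C + 1))) := by
      gcongr
      linarith
    have h3 : (C + 1) * (ε / (4 * (C + 1))) = ε / 4 := by field_simp
    simp only [← mul_sub]
    exact h1.trans (h2.trans h3.le)
  obtain ⟨J, hJ⟩ := Metric.tendsto_atTop.1 (hsmooth ψ hψc hψ) (ε / 4) (by positivity)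
  refine ⟨J, fun j hj => ?_⟩
  have h1 := hsplit _ (hu j)
  have h2 := hsplit _ hv
  have h3 := hJ j hj
  rw [Real.dist_eq] at h3 ⊢
  rw [abs_le] at h1 h2
  rw [abs_lt] at h3 ⊢
  constructor <;> linarith

end WeakDerivatives

/-! ### Sobolev regularity and convergence of the graphs -/

section GraphRegularity

variable {n : ℕ} {R : ℝ} {A : Set (Euc (n + 1))} {N : Euc (n + 1) → Euc (n + 1)}
  {p : Euc (n + 1)} {b : OrthonormalBasis (Fin (n + 1)) ℝ (Euc (n + 1))} {f : Euc n → ℝ}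

lemma memLp_top_lineDeriv {u : Euc n → ℝ} {K : ℝ≥0} (hu : LipschitzWith K u) (e : Euc n)
    (Ω : Set (Euc n)) : MemLp (fun x => lineDeriv ℝ u x e) ⊤ (volume.restrict Ω) :=
  memLp_top_of_bound (measurable_lineDeriv hu.continuous).aestronglyMeasurable (K * ‖e‖)
    (Eventually.of_forall fun _ => norm_lineDeriv_le_of_lipschitz ℝ hu)

namespace IsBoundaryGraph

lemma comp_radialRetraction (hf : IsBoundaryGraph R A p b f) (hR : 0 < R) :
    IsBoundaryGraph R A p b fun x => f (radialRetraction (1 / 10 * R) x) := by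
  intro x hx
  simp only [radialRetraction_of_norm_le (show 0 < 1 / 10 * R by positivity) hx]
  exact hf x hx

lemma lipschitzWith (hf : IsBoundaryGraph R A p b f) (h : IsAlmostAdapted R A N p b)
    (hR : 0 < R) :
    LipschitzWith (2 * 1 : ℝ).toNNReal fun x => f (radialRetraction (1 / 10 * R) x) :=
  lipschitzWith_comp_radialRetraction (by positivity) zero_le_one fun x y hx hy => by
    rw [one_mul]
    exact hf.abs_sub_le h hR hx hy

lemma lipschitzWith_graphGradient (hf : IsBoundaryGraph R A p b f)
    (h : IsAlmostAdapted R A N p b) (hR : 0 < R) (i : Fin n) :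
    LipschitzWith (2 * (12 / R)).toNNReal
      fun x => graphGradient N p b f i (radialRetraction (1 / 10 * R) x) :=
  lipschitzWith_comp_radialRetraction (by positivity) (by positivity) fun x y hx hy =>
    hf.abs_graphGradient_sub_le h hR hx hy i

lemma hasLineDerivAt (hf : IsBoundaryGraph R A p b f) (h : IsAlmostAdapted R A N p b)
    (hR : 0 < R) {x : Euc n} (hx : ‖x‖ < 1 / 10 * R) (i : Fin n) :
    HasLineDerivAt ℝ f (graphGradient N p b f i x) x (EuclideanSpace.single i 1) := by
  rw [HasLineDerivAt, hasDerivAt_iff_isLittleO_nhds_zero]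
  have hO : (fun t : ℝ => f (x + (0 + t) • EuclideanSpace.single i 1)
      - f (x + (0 : ℝ) • EuclideanSpace.single i 1) - t • graphGradient N p b f i x)
      =O[𝓝 0] fun t => t ^ 2 := by
    refine Asymptotics.IsBigO.of_bound (2 / R) ?_
    have hcont : Tendsto (fun t : ℝ => ‖x + (0 + t) • EuclideanSpace.single i (1 : ℝ)‖) (𝓝 0)
        (𝓝 ‖x‖) := by
      have : Continuous fun t : ℝ => ‖x + (0 + t) • EuclideanSpace.single i (1 : ℝ)‖ := by
        fun_prop
      simpa using this.tendsto 0
    filter_upwards [hcont.eventually_lt_const hx] with t ht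
    have := hf.abs_sub_sub_sum_graphGradient_le h hR hx.le ht.le
    rw [zero_smul, add_zero, Real.norm_eq_abs, Real.norm_eq_abs, smul_eq_mul]
    have e1 : ∑ k, graphGradient N p b f k x *
        ((x + (0 + t) • EuclideanSpace.single i (1 : ℝ)).ofLp k - x.ofLp k) =
          t * graphGradient N p b f i x := by
      rw [Finset.sum_eq_single i]
      · simp [mul_comm]
      · intro k _ hk
        simp [hk]
      · simp
    have e2 : ‖x + (0 + t) • EuclideanSpace.single i (1 : ℝ) - x‖ ^ 2 = |t ^ 2| := by
      simp [norm_smul]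
    rwa [e1, e2] at this
  exact hO.trans_isLittleO (Asymptotics.isLittleO_pow_id one_lt_two)

/-- The gradient is classical in the open ball. It is Lipschitz, so its line derivatives exist
almost everywhere and serve as weak Hessian; the default value 0 of `lineDeriv` matters only on a
null set. -/
lemma isW2InftyJet (hf : IsBoundaryGraph R A p b f) (h : IsAlmostAdapted R A N p b)
    (hR : 0 < R) :
    IsW2InftyJet (Metric.ball 0 (1 / 10 * R)) (fun x => f (radialRetraction (1 / 10 * R) x))
      (fun i x => graphGradient N p b f i (radialRetraction (1 / 10 * R) x))
      (fun i k x => lineDeriv ℝ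
        (fun y => graphGradient N p b f i (radialRetraction (1 / 10 * R) y)) x
        (EuclideanSpace.single k 1)) := by
  have hr : 0 < 1 / 10 * R := by positivity
  refine ⟨?_, fun i => ?_, fun i k => ?_, fun i => ?_, fun i k => ?_⟩
  · exact memLp_top_of_bound (hf.lipschitzWith h hR).continuous.aestronglyMeasurable (1 / 10 * R)
      (Eventually.of_forall fun x => (hf _ (norm_radialRetraction_le hr x)).1)
  · exact memLp_top_of_bound (hf.lipschitzWith_graphGradient h hR i).continuous.aestronglyMeasurable
      2 (Eventually.of_forall fun x => hf.abs_graphGradient_le h hR (norm_radialRetraction_le hr x) i)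
  · exact memLp_top_lineDeriv (hf.lipschitzWith_graphGradient h hR i) _ _
  · refine (hf.lipschitzWith h hR).isWeakPartial Metric.isOpen_ball.measurableSet fun x hx => ?_
    rw [mem_ball_zero_iff] at hx
    have heq : (fun y => f (radialRetraction (1 / 10 * R) y)) =ᶠ[𝓝 x] f := by
      filter_upwards [Metric.isOpen_ball.mem_nhds (mem_ball_zero_iff.2 hx)] with y hy
      rw [radialRetraction_of_norm_le hr (mem_ball_zero_iff.1 hy).le]
    rw [radialRetraction_of_norm_le hr hx.le]
    exact ((hf.hasLineDerivAt h hR hx i).congr_of_eventuallyEq heq).lineDeriv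
  · exact (hf.lipschitzWith_graphGradient h hR i).isWeakPartial Metric.isOpen_ball.measurableSet
      fun x _ => rfl

end IsBoundaryGraph

variable {B : Set (Euc (n + 1))} {M : Euc (n + 1) → Euc (n + 1)} {g : Euc n → ℝ} {ε : ℝ}

lemma IsAlmostAdapted.of_close (hR : 0 < R) (hM : IsNormalField R B M) (hN : IsNormalField R A N)
    (hε : 0 < ε) (hεR : 10000 * ε ≤ R) (hBA : SubsetThickening ε B A)
    (hAB : SubsetThickening ε A B) (hp : p ∈ frontier B) (hb : M p = b (Fin.last n)) :
    IsAlmostAdapted R A N p b := by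
  refine ⟨hN, ?_⟩
  obtain ⟨t, ht, hq⟩ := (hM p hp).exists_add_smul_mem_frontier hε (by linarith) hBA hAB
    fun q hq => ⟨N q, hN q hq⟩
  have h1 : ‖p + t • M p - p‖ ≤ 4 * ε := by
    rwa [add_sub_cancel_left, norm_smul, (hM p hp).norm_eq, mul_one, Real.norm_eq_abs]
  refine ⟨_, hq, h1.trans (by linarith), ?_⟩
  have h2 := (hM p hp).sub_sq_le_of_subsetThickening hR hε.le (hN _ hq) hBA
  rw [norm_sub_rev p] at h2
  rw [← hb, norm_sub_rev]
  refine (abs_le_of_sq_le_sq' ?_ (by positivity)).2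
  -- The left side is at most `4(4ε + 2ε) = 24ε`, which `10000ε ≤ R` keeps below `R/400`.
  have : R * ‖M p - N (p + t • M p)‖ ^ 2 ≤ R * (1 / 20) ^ 2 := by linarith
  exact le_of_mul_le_mul_left this hR

lemma IsAlmostAdapted.of_eq (hR : 0 < R) (hM : IsNormalField R B M) (hp : p ∈ frontier B)
    (hb : M p = b (Fin.last n)) : IsAlmostAdapted R B M p b :=
  ⟨hM, p, hp, by simpa using by positivity, by simp [hb]⟩

/-- Graphs of boundaries of close sets are close. -/
lemma IsBoundaryGraph.abs_sub_le_of_close (hR : 0 < R) (hf : IsBoundaryGraph R A p b f)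
    (hA : IsAlmostAdapted R A N p b) (hg : IsBoundaryGraph R B p b g)
    (hB : IsAlmostAdapted R B M p b) (hε : 0 < ε) (hεR : 10000 * ε ≤ R)
    (hAB : SubsetThickening ε A B) (hBA : SubsetThickening ε B A) {x : Euc n}
    (hx : ‖x‖ ≤ 1 / 10 * R) : |f x - g x| ≤ 8 * ε := by
  obtain ⟨q, hq, hqd⟩ := hA.normal.exists_frontier_dist_le hB.normal hε (by linarith) hAB hBA _
    (hf x hx).2
  obtain ⟨y, z, rfl⟩ := exists_eq_coordPoint p b q
  have h0 := norm_coordPoint_sub_origin_le p b hR hx (hf x hx).1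
  rw [dist_eq_norm] at hqd
  have h1 : ‖coordPoint p b y z - p‖ ≤ R / 5 := by
    rw [show coordPoint p b y z - p =
      (coordPoint p b x (f x) - p) - (coordPoint p b x (f x) - coordPoint p b y z) by abel]
    exact (_root_.norm_sub_le _ _).trans (by linarith)
  -- The point found within `4ε` lies over `y` rather than `x`; the cone condition brings it back to
  -- `x` at the cost of another `4ε`.
  have h2 := hB.abs_sub_le hR (hg x hx).2 hq (hg.norm_sub_le hR hx) h1
  have h3 := (norm_sub_le_of_coordPoint p b x y (f x) z).trans hqd
  have h4 : |f x - z| ≤ 4 * ε := by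
    refine (abs_le_of_sq_le_sq' (a := |f x - z|) ?_ (by positivity)).2
    have h5 := norm_coordPoint_sub_sq p b x y (f x) z
    have h6 : ‖coordPoint p b x (f x) - coordPoint p b y z‖ ^ 2 ≤ (4 * ε) ^ 2 := by gcongr
    rw [sq_abs]
    nlinarith [sq_nonneg ‖x - y‖]
  rw [abs_le] at h4 ⊢
  have h7 := abs_le.1 (h2.trans h3)
  constructor <;> linarith

lemma IsBoundaryGraph.normal_sub_sq_le_of_close (hR : 0 < R) (hf : IsBoundaryGraph R A p b f)
    (hA : IsAlmostAdapted R A N p b) (hg : IsBoundaryGraph R B p b g)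
    (hB : IsAlmostAdapted R B M p b) (hε : 0 < ε) (hεR : 10000 * ε ≤ R)
    (hAB : SubsetThickening ε A B) (hBA : SubsetThickening ε B A) {x : Euc n}
    (hx : ‖x‖ ≤ 1 / 10 * R) :
    R * ‖N (coordPoint p b x (f x)) - M (coordPoint p b x (g x))‖ ^ 2 ≤ 40 * ε := by
  have h1 := (hA.normal _ (hf x hx).2).sub_sq_le_of_subsetThickening hR hε.le
    (hB.normal _ (hg x hx).2) hAB
  have h2 := hf.abs_sub_le_of_close hR hA hg hB hε hεR hAB hBA hx
  have h3 : ‖coordPoint p b x (f x) - coordPoint p b x (g x)‖ ≤ 8 * ε := by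
    refine (abs_le_of_sq_le_sq' ?_ (by positivity)).2
    rw [norm_coordPoint_sub_sq, sub_self, norm_zero, ← sq_abs (f x - g x)]
    have : |f x - g x| ^ 2 ≤ (8 * ε) ^ 2 := by gcongr
    linarith
  linarith

variable {E : ℕ → Set (Euc (n + 1))} {NE : ℕ → Euc (n + 1) → Euc (n + 1)}
  {F : ℕ → Euc n → ℝ} {δ : ℕ → ℝ}

/-- Graphs of boundaries of converging sets converge weakly* in `W^{2,∞}`. -/
lemma weakStarW2Infty_of_close (hR : 0 < R) (hF : ∀ j, IsBoundaryGraph R (E j) p b (F j))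
    (hE : ∀ j, IsAlmostAdapted R (E j) (NE j) p b) (hg : IsBoundaryGraph R B p b g)
    (hB : IsAlmostAdapted R B M p b) (hδ : ∀ j, 0 < δ j) (hδR : ∀ j, 10000 * δ j ≤ R)
    (hδ0 : Tendsto δ atTop (𝓝 0)) (h1 : ∀ j, SubsetThickening (δ j) (E j) B)
    (h2 : ∀ j, SubsetThickening (δ j) B (E j)) :
    WeakStarW2Infty (Metric.ball 0 (1 / 10 * R))
      (fun j x => F j (radialRetraction (1 / 10 * R) x))
      (fun x => g (radialRetraction (1 / 10 * R) x)) := by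
  have hr : 0 < 1 / 10 * R := by positivity
  have hFg : ∀ x, ‖x‖ ≤ 1 / 10 * R → Tendsto (fun j => F j x) atTop (𝓝 (g x)) := fun x hx => by
    rw [tendsto_iff_dist_tendsto_zero]
    refine squeeze_zero (fun _ => dist_nonneg) (fun j => ?_)
      (show Tendsto (fun j => 8 * δ j) atTop (𝓝 0) by simpa using hδ0.const_mul 8)
    exact (hF j).abs_sub_le_of_close hR (hE j) hg hB (hδ j) (hδR j) (h1 j) (h2 j) hx
  have hNM : ∀ x, ‖x‖ ≤ 1 / 10 * R → Tendsto (fun j => NE j (coordPoint p b x (F j x))) atTop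
      (𝓝 (M (coordPoint p b x (g x)))) := fun x hx => by
    rw [tendsto_iff_norm_sub_tendsto_zero]
    have h0 : Tendsto (fun j => √(40 * δ j / R)) atTop (𝓝 0) := by
      have := ((hδ0.const_mul 40).div_const R).sqrt
      simpa using this
    refine squeeze_zero (fun _ => norm_nonneg _) (fun j => ?_) h0
    refine Real.le_sqrt_of_sq_le ?_
    rw [le_div_iff₀ hR, mul_comm]
    exact (hF j).normal_sub_sq_le_of_close hR (hE j) hg hB (hδ j) (hδR j) (h1 j) (h2 j) hx
  have hG : ∀ i x, ‖x‖ ≤ 1 / 10 * R → Tendsto (fun j => graphGradient (NE j) p b (F j) i x) atTop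
      (𝓝 (graphGradient M p b g i x)) := fun i x hx => by
    have hc := hg.half_le_inner hB hR hx
    exact ((tendsto_const_nhds.inner (hNM x hx)).neg).div (tendsto_const_nhds.inner (hNM x hx))
      (by linarith)
  refine ⟨_, _, _, _, fun j => (hF j).isW2InftyJet (hE j) hR, hg.isW2InftyJet hB hR, ?_,
    fun i => ?_, fun i k => ?_⟩
  · exact tendsto_integral_mul_of_bounded (fun j => ((hF j).lipschitzWith (hE j) hR).continuous)
      (fun j x => (hF j _ (norm_radialRetraction_le hr x)).1)
      fun x => hFg _ (norm_radialRetraction_le hr x)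
  · exact tendsto_integral_mul_of_bounded
      (fun j => ((hF j).lipschitzWith_graphGradient (hE j) hR i).continuous)
      (fun j x => (hF j).abs_graphGradient_le (hE j) hR (norm_radialRetraction_le hr x) i)
      fun x => hG i _ (norm_radialRetraction_le hr x)
  · exact weakStarLInfty_lineDeriv Metric.isOpen_ball.measurableSet
      (fun j => (hF j).lipschitzWith_graphGradient (hE j) hR i)
      (hg.lipschitzWith_graphGradient hB hR i)
      (fun j x => (hF j).abs_graphGradient_le (hE j) hR (norm_radialRetraction_le hr x) i)
      (fun x => hG i _ (norm_radialRetraction_le hr x)) _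

end GraphRegularity

/-! ### The compactness theorem -/

lemma empty_mem_classU (n : ℕ) (R : ℝ) : (∅ : Set (Euc n)) ∈ classU n R :=
  ⟨isClosed_empty, Bornology.isBounded_empty, fun p hp => by simp at hp⟩

/-- A bounded sequence of non-empty sets in the class has a subsequence that converges, with a
prescribed bound on the Hausdorff distance, to a set in the class. -/
lemma exists_subseq_tendsto_mem_classU {n : ℕ} {R : ℝ} (hR : 0 < R) {E : ℕ → Set (Euc n)}
    (hE : ∀ h, E h ∈ classU n R) (hne : ∀ h, (E h).Nonempty)
    (hb : Bornology.IsBounded (⋃ h, E h)) {c : ℝ} (hc : 0 < c) :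
    ∃ L ∈ classU n R, ∃ (s : ℕ → ℕ) (δ : ℕ → ℝ), StrictMono s ∧ (∀ j, 0 < δ j) ∧ (∀ j, δ j ≤ c) ∧
      Tendsto δ atTop (𝓝 0) ∧ (∀ j, SubsetThickening (δ j) (E (s j)) L) ∧
      ∀ j, SubsetThickening (δ j) L (E (s j)) := by
  obtain ⟨L, s, δ, hL, -, hs, hδ0, hδ, h1, h2⟩ :=
    exists_subseq_hausdorff_tendsto (fun j => (hE j).1) hne hb
  have hLU : L ∈ classU n R := by
    refine ⟨hL.isClosed, hL.isBounded, fun p hp => ?_⟩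
    obtain ⟨ν, hν⟩ := exists_isUnitNormal_of_tendsto (R := R) hL.isClosed
      (fun j => exists_isNormalField hR (hE (s j))) hδ0 h1 h2 hp
    exact ⟨_, _, hν.isTouchingPair hR⟩
  -- Dropping the first `J` terms makes the bound `c` hold for every index.
  obtain ⟨J, hJ⟩ := eventually_atTop.1 (hδ0.eventually_le_const hc)
  have hshift : StrictMono fun j => j + J := fun _ _ h => Nat.add_lt_add_right h J
  exact ⟨L, hLU, fun j => s (j + J), fun j => δ (j + J), hs.comp hshift, fun j => hδ _,
    fun j => hJ _ (Nat.le_add_left _ _), hδ0.comp hshift.tendsto_atTop, fun j => h1 _, fun j => h2 _⟩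

theorem mainTheorem2 (n : ℕ) (R : ℝ) (hR : 0 < R) :
    ∃ η : ℝ, 0 < η ∧ η < 1 ∧
      ∀ E : ℕ → Set (Euc (n + 1)), (∀ h, E h ∈ classU (n + 1) R) →
        Bornology.IsBounded (⋃ h, E h) →
        ∃ L ∈ classU (n + 1) R, ∃ s : ℕ → ℕ, StrictMono s ∧
          KuratowskiTendsto (fun j => E (s j)) L ∧
          L1SetTendsto (fun j => E (s j)) L ∧
          KuratowskiTendsto (fun j => frontier (E (s j))) (frontier L) ∧
          Measure.hausdorffMeasure (n : ℝ) (frontier L) < ⊤ ∧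
          Tendsto (fun j => Measure.hausdorffMeasure (n : ℝ) (frontier (E (s j)))) atTop
            (𝓝 (Measure.hausdorffMeasure (n : ℝ) (frontier L))) ∧
          ∀ p ∈ frontier L, ∀ b : OrthonormalBasis (Fin (n + 1)) ℝ (Euc (n + 1)),
            IsAdapted R L p b →
            ∃ (f : Euc n → ℝ) (fj : ℕ → Euc n → ℝ),
              ContinuousOn f (Metric.closedBall 0 (η * R)) ∧
              MemW2Infty (Metric.ball 0 (η * R)) f ∧
              frontier L ∩ coordCylinder p b (η * R) = coordGraph p b (η * R) f ∧
              (∀ j, ContinuousOn (fj j) (Metric.closedBall 0 (η * R)) ∧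
                MemW2Infty (Metric.ball 0 (η * R)) (fj j)) ∧
              (∀ᶠ j in atTop,
                frontier (E (s j)) ∩ coordCylinder p b (η * R) = coordGraph p b (η * R) (fj j)) ∧
              WeakStarW2Infty (Metric.ball 0 (η * R)) fj f := by
  refine ⟨1 / 10, by norm_num, by norm_num, fun E hE hb => ?_⟩
  -- Blaschke selection needs non-empty sets. If infinitely many sets are empty, they form a
  -- subsequence with limit `∅`; otherwise a tail is non-empty.
  by_cases hempty : ∃ᶠ h in atTop, E h = ∅
  · obtain ⟨s, hs, hsE⟩ := extraction_of_frequently_atTop hempty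
    refine ⟨∅, empty_mem_classU _ _, s, hs, ?_⟩
    have hK : KuratowskiTendsto (fun _ : ℕ => (∅ : Set (Euc (n + 1)))) ∅ :=
      kuratowskiTendsto_of_subsetThickening isClosed_empty (tendsto_const_nhds (x := (0 : ℝ)))
        (fun _ => .refl _) fun _ => .refl _
    simp only [hsE, frontier_empty, measure_empty]
    refine ⟨hK, ?_, hK, ENNReal.zero_lt_top, tendsto_const_nhds, fun p hp => absurd hp (by simp)⟩
    simp [L1SetTendsto]
  obtain ⟨h₀, hh₀⟩ := eventually_atTop.1 (not_frequently.1 hempty)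
  obtain ⟨L, hL, s, δ, hs, hδ, hδR, hδ0, h1, h2⟩ := exists_subseq_tendsto_mem_classU hR
    (E := fun j => E (j + h₀)) (fun j => hE _)
    (fun j => Set.nonempty_iff_ne_empty.2 (hh₀ _ (Nat.le_add_left _ _)))
    (hb.subset (Set.iUnion_subset fun j => Set.subset_iUnion E (j + h₀)))
    (show 0 < R / 10000 by positivity)
  have hEN := fun j => exists_isNormalField hR (hE (s j + h₀))
  have hLN := exists_isNormalField hR hL
  have hLc : IsCompact L := Metric.isCompact_of_isClosed_isBounded hL.1 hL.2.1
  have hδ4 : ∀ j, 4 * δ j ≤ R := fun j => by linarith [hδR j]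
  have hδR' : ∀ j, 10000 * δ j ≤ R := fun j => by linarith [hδR j]
  -- The measure estimate is phrased with `δ = σ²R`; `δ ≤ R/10000` gives `σ ≤ 1/100`, hence `22σ <
  -- 1`.
  have hσ : ∀ j, √(δ j / R) ^ 2 * R = δ j := fun j => by
    rw [Real.sq_sqrt (div_nonneg (hδ j).le hR.le), div_mul_cancel₀ _ hR.ne']
  refine ⟨L, hL, fun j => s j + h₀, fun _ _ h => Nat.add_lt_add_right (hs h) h₀,
    kuratowskiTendsto_of_subsetThickening hL.1 hδ0 h1 h2,
    l1SetTendsto_of_subsetThickening hR hEN hLN hLc hδ hδ4 hδ0 h1 h2, ?_, ?_, ?_, ?_⟩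
  · obtain ⟨M, hM⟩ := hLN
    choose N hN using hEN
    exact kuratowskiTendsto_of_subsetThickening isClosed_frontier
      (show Tendsto (fun j => 4 * δ j) atTop (𝓝 0) by simpa using hδ0.const_mul 4)
      (fun j => (hN j).exists_frontier_dist_le hM (hδ j) (hδ4 j) (h1 j) (h2 j))
      fun j => hM.exists_frontier_dist_le (hN j) (hδ j) (hδ4 j) (h2 j) (h1 j)
  · obtain ⟨M, hM⟩ := hLN
    exact hM.hausdorffMeasure_frontier_lt_top hR hLc
  · refine tendsto_hausdorffMeasure_frontier hR hEN hLN (σ := fun j => √(δ j / R))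
      (fun j => Real.sqrt_pos.2 (div_pos (hδ j) hR)) (fun j => ?_) ?_
      (fun j => by rw [hσ]; exact h1 j) fun j => by rw [hσ]; exact h2 j
    · have : √(δ j / R) ≤ 1 / 100 := by
        refine Real.sqrt_le_iff.2 ⟨by norm_num, ?_⟩
        rw [div_le_iff₀ hR]
        linarith [hδR j]
      linarith
    · simpa using (hδ0.div_const R).sqrt
  · rintro p hp b ⟨p', p'', htouch, hb'⟩
    obtain ⟨M, hM⟩ := hLN
    choose N hN using hEN
    -- Uniqueness of the normal: the chosen field must agree with the axis of any adapted system.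
    have hMb : M p = b (Fin.last n) := by
      have := (hM p hp).mul_norm_sub_le hR (htouch.isUnitNormal hR)
      rw [sub_self, norm_zero, ← hb'] at this
      exact sub_eq_zero.1 (norm_le_zero_iff.1 (nonpos_of_mul_nonpos_right this hR))
    have hLa : IsAlmostAdapted R L M p b := .of_eq hR hM hp hMb
    have hEa : ∀ j, IsAlmostAdapted R (E (s j + h₀)) (N j) p b := fun j =>
      .of_close hR hM (hN j) (hδ j) (hδR' j) (h2 j) (h1 j) hp hMb
    obtain ⟨f, hf⟩ := hLa.exists_isBoundaryGraph hR
    choose F hF using fun j => (hEa j).exists_isBoundaryGraph hR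
    exact ⟨_, _, (hf.lipschitzWith hLa hR).continuous.continuousOn,
      ⟨_, _, hf.isW2InftyJet hLa hR⟩,
      (hf.comp_radialRetraction hR).frontier_inter_coordCylinder hLa hR,
      fun j => ⟨((hF j).lipschitzWith (hEa j) hR).continuous.continuousOn,
        _, _, (hF j).isW2InftyJet (hEa j) hR⟩,
      Eventually.of_forall fun j =>
        ((hF j).comp_radialRetraction hR).frontier_inter_coordCylinder (hEa j) hR,
      weakStarW2Infty_of_close hR hF hEa hf hLa hδ hδR' hδ0 h1 h2⟩
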